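/- Let $(a_{ij})_{0\le i,j\le n}$ be the extended Cartan matrix of an affine Lie algebra $\widehat g$ (untwisted or twisted), and let $d_0,\dots,d_n$ be the coprime positive integers with $d_ia_{ij}=d_ja_{ji}$. Let $q\in\mathbb C^*$ be not a root of unity, fix a square root $q^{1/2}$, and put $q_i=q^{d_i}$, $q_i^{1/2}=(q^{1/2})^{d_i}$. Write $[m]_q=\frac{q^m-q^{-m}}{q-q^{-1}}$, $[m]_q!=[m]_q\cdots[1]_q$, $[0]_q!=1$, $\binom{m}{r}_q=\frac{[m]_q!}{[r]_q!\,[m-r]_q!}$, and $S_q^m(x,y)=\sum_{r=0}^{m}(-1)^r\binom{m}{r}_{q}x^{m-r}y\,x^r$. $U_q(\widehat g)$ is the unital associative $\mathbb C$-algebra with generators $e_i,f_i,q_i^{\pm h_i/2}$ ($0\le i\le n$) and relations $$q_i^{\pm h_i/2}q_i^{\mp h_i/2}=1,\quad q_i^{h_i/2}q_j^{h_j/2}=q_j^{h_j/2}q_i^{h_i/2},\quad q_i^{h_i/2}e_jq_i^{-h_i/2}=q_i^{a_{ij}/2}e_j,\quad q_i^{h_i/2}f_jq_i^{-h_i/2}=q_i^{-a_{ij}/2}f_j,$$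 $$[e_i,f_j]=\delta_{ij}\frac{q_i^{h_i}-q_i^{-h_i}}{q_i-q_i^{-1}},\qquad S_{q_i}^{1-a_{ij}}(e_i,e_j)=S_{q_i}^{1-a_{ij}}(f_i,f_j)=0\quad(i\ne j).$$ Let $c_i,\overline c_i\in\mathbb C$ be arbitrary and $x_i=c_i\overline c_i$. The generalized $q$-Onsager algebra $O_q(\widehat g)$ is the unital associative $\mathbb C$-algebra with generators $A_0,\dots,A_n$ and, for $i\ne j$ and $N=-a_{ij}$, relations $$S_{q_i}^{1+N}(A_i,A_j)=\sum_{k=0}^{\lceil N/2\rceil-1}\rho^k_{ij}\sum_{l=0}^{N-1-2k}(-1)^l\gamma^{kl}_{ij}\,A_i^{N-1-2k-l}A_jA_i^l .$$ Here $\gamma^{kl}_{ij}=1$, except that $$\gamma^{01}_{ij}=\frac{(q_i+q_i^{-1})(q_i^2+q_i^{-2})(q_i^2+3+q_i^{-2})}{q_i^4+2q_i^2+4+2q_i^{-2}+q_i^{-4}}\ \ (a_{ij}=-3),\qquad \gamma^{01}_{ij}=\gamma^{02}_{ij}=\frac{[3]_{q_i}[5]_{q_i}}{q_i^4+q_i^{-4}+3}\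 \ (a_{ij}=-4),$$ where $q$ is assumed to be such that the denominators that occur for $\widehat g$ are non-zero. The structure constants are - $\rho^0_{ij}=x_i$ if $a_{ij}=-1$; - $\rho^0_{ij}=x_i(q_i+q_i^{-1})^2$ if $a_{ij}=-2$; - $\rho^0_{ij}=x_i(q_i^4+2q_i^2+4+2q_i^{-2}+q_i^{-4})$ and $\rho^1_{ij}=-x_i^2(q_i^2+1+q_i^{-2})^2$ if $a_{ij}=-3$; - $\rho^0_{ij}=x_i(q_i+q_i^{-1})^2(q_i^4+3+q_i^{-4})$ and $\rho^1_{ij}=-x_i^2(q_i+q_i^{-1})^4(q_i^2+q_i^{-2})^2$ if $a_{ij}=-4$. Then $U_q(\widehat g)$ is a bialgebra with comultiplication $\Delta$ and counit $\mathcal E$ given by $$\Delta(e_i)=e_i\otimes q_i^{-h_i/2}+q_i^{h_i/2}\otimes e_i,\quad \Delta(f_i)=f_i\otimes q_i^{-h_i/2}+q_i^{h_i/2}\otimes f_i,\quad \Delta(q_i^{\pm h_i/2})=q_i^{\pm h_i/2}\otimes q_i^{\pm h_i/2},$$ $$\mathcal E(e_i)=\mathcal E(f_i)=0,\qquad \mathcal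 E(q_i^{\pm h_i/2})=1,$$ and there is an algebra homomorphism $\delta:O_q(\widehat g)\to U_q(\widehat g)\otimes O_q(\widehat g)$ with $$\delta(A_i)=\bigl(c_i\,e_iq_i^{h_i/2}+\overline c_i\,f_iq_i^{h_i/2}\bigr)\otimes 1+q_i^{h_i}\otimes A_i\qquad(0\le i\le n),$$ which makes $O_q(\widehat g)$ a left $U_q(\widehat g)$-comodule algebra: $(\Delta\otimes\mathrm{id})\circ\delta=(\mathrm{id}\otimes\delta)\circ\delta$ and $(\mathcal E\otimes\mathrm{id})\circ\delta=\mathrm{id}$ (under the usual identifications). -/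

import Mathlib

open scoped TensorProduct

/-! ## Affine generalized Cartan matrices -/

/-- `a` is an (indecomposable) generalized Cartan matrix of affine type, in the sense of Kac:
besides the axioms of a generalized Cartan matrix and indecomposability, there is a vector of
positive integers (the marks) annihilated by `a`. By the classification, these are, up to
renumbering the nodes, the extended Cartan matrices of the affine Lie algebras, untwisted and
twisted: `A_n^(1)`, `B_n^(1)`, `C_n^(1)`, `D_n^(1)`, `E_6^(1)`, `E_7^(1)`, `E_8^(1)`, `F_4^(1)`,
`G_2^(1)`, `A_2^(2)`, `A_{2n}^(2)`, `A_{2n-1}^(2)`, `D_{n+1}^(2)`, `E_6^(2)`, `D_4^(3)`. -/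
structure IsAffineCartanMatrix {n : ℕ} (a : Matrix (Fin (n + 1)) (Fin (n + 1)) ℤ) : Prop where
  diag : ∀ i, a i i = 2
  nonpos : ∀ i j, i ≠ j → a i j ≤ 0
  zero_symm : ∀ i j, a i j = 0 → a j i = 0
  indecomposable : ∀ S : Set (Fin (n + 1)), S.Nonempty → Sᶜ.Nonempty →
    ∃ i ∈ S, ∃ j ∈ Sᶜ, a i j ≠ 0
  null : ∃ u : Fin (n + 1) → ℤ, (∀ i, 0 < u i) ∧ a.mulVec u = 0

/-! ## `q`-numbers -/

/-- The `q`-number `[m]_q = (q ^ m - q ^ (-m)) / (q - q⁻¹)`. -/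
noncomputable def qNum (q : ℂ) (m : ℕ) : ℂ := (q ^ m - (q⁻¹) ^ m) / (q - q⁻¹)

/-- The `q`-factorial `[m]_q! = [m]_q [m-1]_q ⋯ [1]_q`, with `[0]_q! = 1`. -/
noncomputable def qFact (q : ℂ) : ℕ → ℂ
  | 0 => 1
  | m + 1 => qNum q (m + 1) * qFact q m

/-- The `q`-binomial coefficient `[m]_q! / ([r]_q! [m-r]_q!)`; only used for `r ≤ m`. -/
noncomputable def qBinom (q : ℂ) (m r : ℕ) : ℂ := qFact q m / (qFact q r * qFact q (m - r))

/-- The `q`-Serre expression `∑_{r=0}^{m} (-1)^r [m choose r]_q x^{m-r} y x^r`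
(used with `m = 1 - a_{ij}`). -/
noncomputable def qSerre {B : Type*} [Ring B] [Algebra ℂ B] (q : ℂ) (m : ℕ) (x y : B) : B :=
  ∑ r ∈ Finset.range (m + 1), ((-1) ^ r * qBinom q m r) • (x ^ (m - r) * y * x ^ r)

/-! ## The quantum affine algebra

Throughout, `s` is a fixed square root of the deformation parameter `q`, so that
`q_i = q ^ d_i = (s ^ 2) ^ d_i` and `q_i ^ (m / 2) = (s ^ d_i) ^ m` for an integer `m`. -/

/-- The parameter `q_i = q ^ d_i`, where `q = s ^ 2`. -/
noncomputable def qi {n : ℕ} (d : Fin (n + 1) → ℕ) (s : ℂ) (i : Fin (n + 1)) : ℂ := (s ^ 2) ^ d i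

/-- Generators of the quantum affine algebra: `e i`, `f i`, and `k i`, `kinv i` standing for
`q_i ^ (h_i / 2)` and `q_i ^ (-h_i / 2)`. -/
inductive UqGen (n : ℕ) : Type
  | e (i : Fin (n + 1))
  | f (i : Fin (n + 1))
  | k (i : Fin (n + 1))
  | kinv (i : Fin (n + 1))

namespace UqGen

/-- `e_i` in the free algebra. -/
noncomputable def E {n : ℕ} (i : Fin (n + 1)) : FreeAlgebra ℂ (UqGen n) := FreeAlgebra.ι ℂ (.e i)
/-- `f_i` in the free algebra. -/
noncomputable def F {n : ℕ} (i : Fin (n + 1)) : FreeAlgebra ℂ (UqGen n) := FreeAlgebra.ι ℂ (.f i)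
/-- `q_i ^ (h_i / 2)` in the free algebra. -/
noncomputable def K {n : ℕ} (i : Fin (n + 1)) : FreeAlgebra ℂ (UqGen n) := FreeAlgebra.ι ℂ (.k i)
/-- `q_i ^ (-h_i / 2)` in the free algebra. -/
noncomputable def Kinv {n : ℕ} (i : Fin (n + 1)) : FreeAlgebra ℂ (UqGen n) :=
  FreeAlgebra.ι ℂ (.kinv i)

end UqGen

open UqGen in
/-- The defining relations of the quantum affine algebra. For `a i j = 0` the `q`-Serre relations
say `e_i e_j = e_j e_i` and `f_i f_j = f_j f_i`. -/
inductive UqRel {n : ℕ} (a : Matrix (Fin (n + 1)) (Fin (n + 1)) ℤ) (d : Fin (n + 1) → ℕ) (s : ℂ) :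
    FreeAlgebra ℂ (UqGen n) → FreeAlgebra ℂ (UqGen n) → Prop
  | k_kinv (i) : UqRel a d s (K i * Kinv i) 1
  | kinv_k (i) : UqRel a d s (Kinv i * K i) 1
  | k_comm (i j) : UqRel a d s (K i * K j) (K j * K i)
  | k_e (i j) : UqRel a d s (K i * E j * Kinv i) ((s ^ d i) ^ (a i j) • E j)
  | k_f (i j) : UqRel a d s (K i * F j * Kinv i) ((s ^ d i) ^ (-(a i j)) • F j)
  | e_f_same (i) : UqRel a d s (E i * F i - F i * E i)
      ((qi d s i - (qi d s i)⁻¹)⁻¹ • (K i ^ 2 - Kinv i ^ 2))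
  | e_f (i j) : i ≠ j → UqRel a d s (E i * F j - F j * E i) 0
  | serre_e (i j) : i ≠ j → UqRel a d s (qSerre (qi d s i) (1 - a i j).toNat (E i) (E j)) 0
  | serre_f (i j) : i ≠ j → UqRel a d s (qSerre (qi d s i) (1 - a i j).toNat (F i) (F j)) 0

/-- The quantum affine algebra attached to the Cartan matrix `a`, the symmetrizing integers `d` and
`q = s ^ 2`. -/
abbrev Uq {n : ℕ} (a : Matrix (Fin (n + 1)) (Fin (n + 1)) ℤ) (d : Fin (n + 1) → ℕ) (s : ℂ) : Type :=
  RingQuot (UqRel a d s)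

namespace Uq

variable {n : ℕ} (a : Matrix (Fin (n + 1)) (Fin (n + 1)) ℤ) (d : Fin (n + 1) → ℕ) (s : ℂ)

/-- The generator `e_i`. -/
noncomputable def e (i : Fin (n + 1)) : Uq a d s := RingQuot.mkAlgHom ℂ (UqRel a d s) (UqGen.E i)
/-- The generator `f_i`. -/
noncomputable def f (i : Fin (n + 1)) : Uq a d s := RingQuot.mkAlgHom ℂ (UqRel a d s) (UqGen.F i)
/-- The generator `q_i ^ (h_i / 2)`. -/
noncomputable def k (i : Fin (n + 1)) : Uq a d s := RingQuot.mkAlgHom ℂ (UqRel a d s) (UqGen.K i)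
/-- The generator `q_i ^ (-h_i / 2)`. -/
noncomputable def kinv (i : Fin (n + 1)) : Uq a d s :=
  RingQuot.mkAlgHom ℂ (UqRel a d s) (UqGen.Kinv i)

end Uq

/-! ## The generalized `q`-Onsager algebra -/

/-- The constants `γ^{k l}_{i j}`, as a function of `q_i`, `N = -a_{ij}`, `k` and `l`. -/
noncomputable def gammaConst (q : ℂ) : ℕ → ℕ → ℕ → ℂ
  | 3, 0, 1 => (q + q⁻¹) * (q ^ 2 + (q⁻¹) ^ 2) * (q ^ 2 + 3 + (q⁻¹) ^ 2) /
      (q ^ 4 + 2 * q ^ 2 + 4 + 2 * (q⁻¹) ^ 2 + (q⁻¹) ^ 4)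
  | 4, 0, 1 => qNum q 3 * qNum q 5 / (q ^ 4 + (q⁻¹) ^ 4 + 3)
  | 4, 0, 2 => qNum q 3 * qNum q 5 / (q ^ 4 + (q⁻¹) ^ 4 + 3)
  | _, _, _ => 1

/-- The right-hand side
`∑_{k=0}^{⌈N/2⌉-1} ρ^k ∑_{l=0}^{N-1-2k} (-1)^l γ^{kl} x^{N-1-2k-l} y x^l`
of the defining relations of the generalized `q`-Onsager algebra, with `N = -a_{ij}`. -/
noncomputable def onsagerRHS {B : Type*} [Ring B] [Algebra ℂ B] (q : ℂ) (N : ℕ) (ρ : ℕ → ℂ)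
    (x y : B) : B :=
  ∑ k ∈ Finset.range ((N + 1) / 2), ρ k • ∑ l ∈ Finset.range (N - 2 * k),
    ((-1) ^ l * gammaConst q N k l) • (x ^ (N - 1 - 2 * k - l) * y * x ^ l)

/-- The defining relations of the generalized `q`-Onsager algebra with structure constants
`ρ i j k = ρ^k_{ij}`. -/
inductive OqRel {n : ℕ} (a : Matrix (Fin (n + 1)) (Fin (n + 1)) ℤ) (d : Fin (n + 1) → ℕ) (s : ℂ)
    (ρ : Fin (n + 1) → Fin (n + 1) → ℕ → ℂ) :
    FreeAlgebra ℂ (Fin (n + 1)) → FreeAlgebra ℂ (Fin (n + 1)) → Prop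
  | rel (i j) : i ≠ j → OqRel a d s ρ
      (qSerre (qi d s i) (1 - a i j).toNat (FreeAlgebra.ι ℂ i) (FreeAlgebra.ι ℂ j))
      (onsagerRHS (qi d s i) (-(a i j)).toNat (ρ i j) (FreeAlgebra.ι ℂ i) (FreeAlgebra.ι ℂ j))

/-- The generalized `q`-Onsager algebra with structure constants `ρ i j k = ρ^k_{ij}`. -/
abbrev Oq {n : ℕ} (a : Matrix (Fin (n + 1)) (Fin (n + 1)) ℤ) (d : Fin (n + 1) → ℕ) (s : ℂ)
    (ρ : Fin (n + 1) → Fin (n + 1) → ℕ → ℂ) : Type :=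
  RingQuot (OqRel a d s ρ)

/-- The generator `A_i` of the generalized `q`-Onsager algebra. -/
noncomputable def Oq.A {n : ℕ} (a : Matrix (Fin (n + 1)) (Fin (n + 1)) ℤ) (d : Fin (n + 1) → ℕ)
    (s : ℂ) (ρ : Fin (n + 1) → Fin (n + 1) → ℕ → ℂ) (i : Fin (n + 1)) : Oq a d s ρ :=
  RingQuot.mkAlgHom ℂ (OqRel a d s ρ) (FreeAlgebra.ι ℂ i)

/-- The structure constants `ρ^k_{ij}` belonging to the parameters `c_i`, `c̄_i`, as a function of
`q_i`, `x = c_i c̄_i`, `N = -a_{ij}` and `k`. -/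
noncomputable def rhoConst (q x : ℂ) : ℕ → ℕ → ℂ
  | 1, 0 => x
  | 2, 0 => x * (q + q⁻¹) ^ 2
  | 3, 0 => x * (q ^ 4 + 2 * q ^ 2 + 4 + 2 * (q⁻¹) ^ 2 + (q⁻¹) ^ 4)
  | 3, 1 => -x ^ 2 * (q ^ 2 + 1 + (q⁻¹) ^ 2) ^ 2
  | 4, 0 => x * (q + q⁻¹) ^ 2 * (q ^ 4 + 3 + (q⁻¹) ^ 4)
  | 4, 1 => -x ^ 2 * (q + q⁻¹) ^ 4 * (q ^ 2 + (q⁻¹) ^ 2) ^ 2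
  | _, _ => 0

/-- The structure constants `ρ^k_{ij}` determined by the parameters `c_i` and `c̄_i = cbar i`. -/
noncomputable def onsagerRho {n : ℕ} (a : Matrix (Fin (n + 1)) (Fin (n + 1)) ℤ)
    (d : Fin (n + 1) → ℕ) (s : ℂ) (c cbar : Fin (n + 1) → ℂ) (i j : Fin (n + 1)) (k : ℕ) : ℂ :=
  rhoConst (qi d s i) (c i * cbar i) (-(a i j)).toNat k

/-! ## Comodule algebras -/

/-- The algebra homomorphism `δ : A → H ⊗ A` makes `A` a left comodule algebra over the
bialgebra `H`: it is coassociative and counital. -/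
structure IsLeftComoduleAlgebra (R : Type*) {H A : Type*} [CommSemiring R] [Semiring H]
    [Bialgebra R H] [Semiring A] [Algebra R A] (δ : A →ₐ[R] H ⊗[R] A) : Prop where
  coassoc : (Algebra.TensorProduct.assoc R R R H H A).toAlgHom.comp
      ((Algebra.TensorProduct.map (Bialgebra.comulAlgHom R H) (AlgHom.id R A)).comp δ) =
    (Algebra.TensorProduct.map (AlgHom.id R H) δ).comp δ
  counit : (Algebra.TensorProduct.lid R A).toAlgHom.comp
      ((Algebra.TensorProduct.map (Bialgebra.counitAlgHom R H) (AlgHom.id R A)).comp δ) =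
    AlgHom.id R A

/-! The only substantial point is that `Δ` and `δ` respect the Serre and Onsager relations;
coassociativity and counitality are then checked on generators.

Put `N = -a_{ij}` and `w = q_i ^ (-N)`. The operators `z ↦ X z - q_i ^ (2k) w z X`, for `k = 0, …,
N`, compose to the `q`-Serre expression. Adding a term `θ z` two steps back, with `x_i = θ (q_i -
q_i⁻¹) ^ 2`, yields the Serre expression minus the Onsager right-hand side (`serreSeq_eq`, checked
for each `N ≤ 4`; the affine condition gives this bound). Normalized by `chainCoeff`, which vanishes
exactly when the recursion should stop, a relation between `X` and `Y` becomes the existence of a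
chain `0, Y, z 2, …` (`IsSerreChain`). Proving a relation thus means exhibiting a chain, which can
be guessed from representation theory.

For the coaction, `X = E + F + K A`, where `E = c e_i k_i`, `F = c̄ f_i k_i`, `K = k_i ^ 2` satisfy
`sl_2`-type relations (`IsLadder`). The relation is linear in `Y`, so each summand of `δ(A_j)` is
treated alone. The string that `E` generates from `e_j k_j` is a chain for `X`: `F` lowers it and so
supplies the `θ`-term, while `K A` acts by a scalar twist (`IsLadder.isSerreChain_string`). The
summand `f_j k_j` follows by exchanging `E` with `F` and `q_i` with its inverse. For `k_j ^ 2 ⊗ A_j`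
the chain is a convolution of divided powers of `E` with the chain of `A_j`
(`IsLadder.isSerreChain_tensor`). The Serre relations for `Δ` use the same method with `θ = 0`
(`IsSerrePair.qSerre_comul`). -/

section Chains

/-! ### Three-term recursions and chains. -/

variable {B : Type*} [Ring B] [Algebra ℂ B]

/-- The coefficient `(1 - q ^ (2k+2)) (1 - q ^ (2k) w ^ 2)` of the normalized three-term
recursion. -/
noncomputable def chainCoeff (q w : ℂ) (k : ℕ) : ℂ :=
  (1 - q ^ (2 * k + 2)) * (1 - q ^ (2 * k) * w ^ 2)

/-- The unnormalized three-term recursion, shifted by one so that it starts with `0, Y`. -/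
noncomputable def serreSeq (q w θ : ℂ) (X Y : B) : ℕ → B
  | 0 => 0
  | 1 => Y
  | 2 => X * Y - w • (Y * X)
  | k + 3 => X * serreSeq q w θ X Y (k + 2) - (q ^ (2 * (k + 1)) * w) •
      (serreSeq q w θ X Y (k + 2) * X) + (θ * chainCoeff q w k) • serreSeq q w θ X Y (k + 1)

/-- A sequence `0, z 1, z 2, …` obeying the normalized three-term recursion up to step `N`.
For `w = q ^ (-N)` the coefficient vanishes at the last step, which makes this a condition on
`X` and `z 1`. -/
structure IsSerreChain (q w θ : ℂ) (N : ℕ) (X : B) (z : ℕ → B) : Prop where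
  zero : z 0 = 0
  step : ∀ k ≤ N, chainCoeff q w k • z (k + 2) =
    X * z (k + 1) - (q ^ (2 * k) * w) • (z (k + 1) * X) + θ • z k

/-- Clearing denominators: the `θ`-term reaches back two indices and so retains one extra
coefficient, which is the factor `chainCoeff q w k` in `serreSeq`. -/
lemma prod_chainCoeff_smul {q w θ : ℂ} {N : ℕ} {X : B} {z : ℕ → B} (h0 : z 0 = 0)
    (h : ∀ k < N, chainCoeff q w k • z (k + 2) =
      X * z (k + 1) - (q ^ (2 * k) * w) • (z (k + 1) * X) + θ • z k) (k : ℕ) (hk : k ≤ N) :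
    (∏ i ∈ Finset.range k, chainCoeff q w i) • z (k + 1) = serreSeq q w θ X (z 1) (k + 1) := by
  induction k using Nat.strong_induction_on with
  | _ k ih =>
  match k with
  | 0 => simp [serreSeq]
  | 1 => have := h 0 (by omega); simpa [serreSeq, h0] using this
  | k + 2 =>
    rw [serreSeq, ← ih (k + 1) (by omega) (by omega), ← ih k (by omega) (by omega),
      Finset.prod_range_succ, mul_smul, h (k + 1) (by omega), Finset.prod_range_succ]
    simp only [mul_smul_comm, smul_mul_assoc, smul_add, smul_sub, smul_smul]
    congr 2
    · congr 1; ring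
    · ring

/-- The step `k = N` is kept undivided, because its coefficient will be zero in the application. -/
lemma prod_chainCoeff_smul_last {q w θ : ℂ} {N : ℕ} {X : B} {z : ℕ → B} (h0 : z 0 = 0)
    (h : ∀ k < N, chainCoeff q w k • z (k + 2) =
      X * z (k + 1) - (q ^ (2 * k) * w) • (z (k + 1) * X) + θ • z k) :
    (∏ i ∈ Finset.range N, chainCoeff q w i) •
      (X * z (N + 1) - (q ^ (2 * N) * w) • (z (N + 1) * X) + θ • z N) =
      serreSeq q w θ X (z 1) (N + 2) := by
  match N with
  | 0 => simp [serreSeq, h0]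
  | N + 1 =>
    rw [serreSeq, ← prod_chainCoeff_smul h0 h (N + 1) le_rfl,
      ← prod_chainCoeff_smul h0 h N (by omega), Finset.prod_range_succ]
    simp only [mul_smul_comm, smul_mul_assoc, smul_add, smul_sub, smul_smul]
    congr 2
    · congr 1; ring
    · ring

lemma chainCoeff_ne_zero {q w : ℂ} {N : ℕ} (hw : w * q ^ N = 1)
    (hq : ∀ m : ℕ, 0 < m → q ^ m ≠ 1) {k : ℕ} (hk : k < N) : chainCoeff q w k ≠ 0 := by
  refine mul_ne_zero (sub_ne_zero.2 (hq _ (by omega)).symm) (sub_ne_zero.2 fun h => ?_)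
  apply hq (2 * (N - k)) (by omega)
  have : q ^ (2 * N) = q ^ (2 * k) * q ^ (2 * (N - k)) := by rw [← pow_add]; congr 1; omega
  have h1 : q ^ (2 * N) * w ^ 2 = 1 := by
    rw [show q ^ (2 * N) * w ^ 2 = (w * q ^ N) ^ 2 by ring, hw, one_pow]
  rw [this, mul_right_comm, ← h, one_mul] at h1
  exact h1

lemma chainCoeff_last {q w : ℂ} {N : ℕ} (hw : w * q ^ N = 1) : chainCoeff q w N = 0 := by
  rw [chainCoeff, show q ^ (2 * N) * w ^ 2 = (w * q ^ N) ^ 2 by ring, hw]; ring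

/-- The normalized sequence generated by `Y`. -/
noncomputable def chainSeq (q w θ : ℂ) (X Y : B) : ℕ → B
  | 0 => 0
  | 1 => Y
  | k + 2 => (chainCoeff q w k)⁻¹ • (X * chainSeq q w θ X Y (k + 1) - (q ^ (2 * k) * w) •
      (chainSeq q w θ X Y (k + 1) * X) + θ • chainSeq q w θ X Y k)

lemma IsSerreChain.serreSeq_eq_zero {q w θ : ℂ} {N : ℕ} {X : B} {z : ℕ → B} (hw : w * q ^ N = 1)
    (h : IsSerreChain q w θ N X z) : serreSeq q w θ X (z 1) (N + 2) = 0 := by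
  rw [← prod_chainCoeff_smul_last h.zero fun k hk => h.step k hk.le, ← h.step N le_rfl,
    chainCoeff_last hw, zero_smul, smul_zero]

/-- Below `N` the coefficients are invertible, so the recursion can be solved; at `N` the
coefficient is zero and the remaining condition is precisely the vanishing of `serreSeq`. -/
lemma isSerreChain_chainSeq {q w θ : ℂ} {N : ℕ} {X Y : B} (hw : w * q ^ N = 1)
    (hq : ∀ m : ℕ, 0 < m → q ^ m ≠ 1) (h : serreSeq q w θ X Y (N + 2) = 0) :
    IsSerreChain q w θ N X (chainSeq q w θ X Y) := by
  have key : ∀ k < N, chainCoeff q w k • chainSeq q w θ X Y (k + 2) =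
      X * chainSeq q w θ X Y (k + 1) - (q ^ (2 * k) * w) • (chainSeq q w θ X Y (k + 1) * X)
        + θ • chainSeq q w θ X Y k := fun k hk => by
    rw [chainSeq, smul_inv_smul₀ (chainCoeff_ne_zero hw hq hk)]
  refine ⟨by rw [chainSeq], fun k hk => ?_⟩
  rcases hk.lt_or_eq with hk | rfl
  · exact key k hk
  · have := prod_chainCoeff_smul_last (by rw [chainSeq]) key
    rw [chainSeq, h, smul_eq_zero_iff_right] at this
    · rw [this, chainCoeff_last hw, zero_smul]
    · exact Finset.prod_ne_zero_iff.2 fun i hi =>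
        chainCoeff_ne_zero hw hq (Finset.mem_range.1 hi)

/-- With `θ = 0` each member is homogeneous, of degree `k` in `X` and one in `Y`, hence a weight
vector for `K`. -/
lemma chainSeq_semiconj {q w α β : ℂ} {X Y K : B} (hX : K * X = α • (X * K))
    (hY : K * Y = β • (Y * K)) (k : ℕ) :
    K * chainSeq q w 0 X Y (k + 1) = (α ^ k * β) • (chainSeq q w 0 X Y (k + 1) * K) := by
  induction k with
  | zero => simpa [chainSeq] using hY
  | succ k ih =>
    rw [chainSeq, zero_smul, add_zero]
    set z := chainSeq q w 0 X Y (k + 1)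
    simp only [mul_smul_comm, smul_mul_assoc, smul_smul, mul_sub, sub_mul]
    rw [← mul_assoc, hX, ← mul_assoc, ih, smul_mul_assoc, smul_mul_assoc, mul_assoc, ih,
      mul_assoc z K X, hX, mul_assoc z X K, mul_assoc X z K]
    simp only [mul_smul_comm, smul_smul, smul_sub]
    congr 2 <;> ring

/-- The factor `τ k` accumulates the Cartan elements that distinguish `E` from `x`. The truncated
index `k - 1` is harmless at `0`, where `u` vanishes. -/
lemma IsSerreChain.twist {q w : ℂ} {N : ℕ} {x E : B} {u τ : ℕ → B} (h : IsSerreChain q w 0 N x u)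
    (hl : ∀ k, E * (u (k + 1) * τ k) = x * u (k + 1) * τ (k + 1))
    (hr : ∀ k, u (k + 1) * τ k * E = u (k + 1) * x * τ (k + 1)) :
    IsSerreChain q w 0 N E fun k => u k * τ (k - 1) := by
  refine ⟨by simp [h.zero], fun k hk => ?_⟩
  have := congrArg (· * τ (k + 1)) (h.step k hk)
  simp only [zero_smul, add_zero, sub_mul, smul_mul_assoc] at this
  simp only [Nat.add_sub_cancel, zero_smul, add_zero, hl, hr, show k + 2 - 1 = k + 1 by omega]
  exact this

/-- A summand `G` whose twisted commutator with the chain is `-θ z k` changes the recursion only by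
the required `θ`-term. -/
lemma IsSerreChain.add_semiconj {q w θ : ℂ} {N : ℕ} {E G : B} {z : ℕ → B}
    (h : IsSerreChain q w 0 N E z)
    (hG : ∀ k ≤ N, G * z (k + 1) = (q ^ (2 * k) * w) • (z (k + 1) * G) - θ • z k) :
    IsSerreChain q w θ N (E + G) z := by
  refine ⟨h.zero, fun k hk => ?_⟩
  rw [h.step k hk, add_mul, mul_add, hG k hk]
  module

lemma IsSerreChain.map {C : Type*} [Ring C] [Algebra ℂ C] {q w θ : ℂ} {N : ℕ} {X : B} {z : ℕ → B}
    (h : IsSerreChain q w θ N X z) (φ : B →ₐ[ℂ] C) : IsSerreChain q w θ N (φ X)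
      fun k => φ (z k) := by
  refine ⟨by simp [h.zero], fun k hk => ?_⟩
  simpa using congrArg φ (h.step k hk)

end Chains

/-! ### `q`-numbers, and the recursion compared with the defining relations. -/

section QNumbers

lemma qNum_inv (q : ℂ) (m : ℕ) : qNum q⁻¹ m = qNum q m := by
  rw [qNum, qNum, inv_inv, ← neg_sub, ← neg_sub q, neg_div_neg_eq]

lemma qFact_inv (q : ℂ) (m : ℕ) : qFact q⁻¹ m = qFact q m := by
  induction m with
  | zero => rfl
  | succ m ih => rw [qFact, qFact, ih, qNum_inv]

lemma sub_inv_ne_zero {q : ℂ} (hq0 : q ≠ 0) (hq : ∀ m : ℕ, 0 < m → q ^ m ≠ 1) : q - q⁻¹ ≠ 0 := by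
  intro h
  apply hq 2 two_pos
  rw [sub_eq_zero] at h
  rw [pow_two]; nth_rewrite 2 [h]; exact mul_inv_cancel₀ hq0

lemma qNum_ne_zero {q : ℂ} (hq0 : q ≠ 0) (hq : ∀ m : ℕ, 0 < m → q ^ m ≠ 1) {m : ℕ} (hm : 0 < m) :
    qNum q m ≠ 0 := by
  refine div_ne_zero (fun h => hq (2 * m) (by omega) ?_) (sub_inv_ne_zero hq0 hq)
  rw [sub_eq_zero] at h
  rw [two_mul, pow_add]; nth_rewrite 2 [h]; rw [← mul_pow, mul_inv_cancel₀ hq0, one_pow]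

lemma qFact_ne_zero {q : ℂ} (hq0 : q ≠ 0) (hq : ∀ m : ℕ, 0 < m → q ^ m ≠ 1) (m : ℕ) :
    qFact q m ≠ 0 := by
  induction m with
  | zero => exact one_ne_zero
  | succ m ih => exact mul_ne_zero (qNum_ne_zero hq0 hq m.succ_pos) ih

lemma qNum_eq_iff {q : ℂ} (h : q - q⁻¹ ≠ 0) (m : ℕ) (y : ℂ) :
    qNum q m = y ↔ q ^ m - q⁻¹ ^ m = y * (q - q⁻¹) := by
  rw [qNum, div_eq_iff h]

lemma qBinom_zero_right {q : ℂ} (hq0 : q ≠ 0) (hq : ∀ m : ℕ, 0 < m → q ^ m ≠ 1) (m : ℕ) :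
    qBinom q m 0 = 1 := by
  rw [qBinom, qFact, one_mul, Nat.sub_zero, div_self (qFact_ne_zero hq0 hq m)]

lemma qBinom_self {q : ℂ} (hq0 : q ≠ 0) (hq : ∀ m : ℕ, 0 < m → q ^ m ≠ 1) (m : ℕ) :
    qBinom q m m = 1 := by
  rw [qBinom, Nat.sub_self, qFact, mul_one, div_self (qFact_ne_zero hq0 hq m)]

lemma qNum_one {q : ℂ} (h : q - q⁻¹ ≠ 0) : qNum q 1 = 1 := by
  rw [qNum_eq_iff h]; ring

lemma qBinom_one_right {q : ℂ} (hq0 : q ≠ 0) (hq : ∀ m : ℕ, 0 < m → q ^ m ≠ 1) (m : ℕ) :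
    qBinom q (m + 1) 1 = qNum q (m + 1) := by
  rw [qBinom, qFact, qFact, qFact, Nat.add_sub_cancel, qNum_one (sub_inv_ne_zero hq0 hq), one_mul,
    one_mul, mul_div_cancel_right₀ _ (qFact_ne_zero hq0 hq m)]

lemma qBinom_symm (q : ℂ) {m r : ℕ} (h : r ≤ m) : qBinom q m (m - r) = qBinom q m r := by
  rw [qBinom, qBinom, Nat.sub_sub_self h, mul_comm]

lemma qBinom_two_right {q : ℂ} (hq0 : q ≠ 0) (hq : ∀ m : ℕ, 0 < m → q ^ m ≠ 1) (m : ℕ) :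
    qBinom q (m + 2) 2 = qNum q (m + 2) * qNum q (m + 1) / qNum q 2 := by
  rw [qBinom, Nat.add_sub_cancel, qFact, qFact, qFact, qFact, qFact,
    qNum_one (sub_inv_ne_zero hq0 hq), one_mul, mul_one, ← mul_assoc,
    mul_div_mul_right _ _ (qFact_ne_zero hq0 hq m)]

variable {B : Type*} [Ring B] [Algebra ℂ B]

/-- This invariance, with its analogues for the Onsager side, lets statements about the `e_i` be
reused for the `f_i` with `q` inverted. -/
lemma qSerre_inv (q : ℂ) (m : ℕ) (X Y : B) : qSerre q⁻¹ m X Y = qSerre q m X Y := by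
  simp [qSerre, qBinom, qFact_inv]

lemma gammaConst_inv (q : ℂ) (N k l : ℕ) : gammaConst q⁻¹ N k l = gammaConst q N k l := by
  unfold gammaConst
  split <;> simp only [inv_inv, qNum_inv] <;> congr 1 <;> ring

lemma rhoConst_inv (q x : ℂ) (N k : ℕ) : rhoConst q⁻¹ x N k = rhoConst q x N k := by
  unfold rhoConst
  split <;> simp only [inv_inv] <;> ring

lemma onsagerRHS_inv (q : ℂ) (N : ℕ) (ρ : ℕ → ℂ) (X Y : B) :
    onsagerRHS q⁻¹ N ρ X Y = onsagerRHS q N ρ X Y := by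
  simp only [onsagerRHS, gammaConst_inv]

lemma onsagerRHS_rhoConst_zero (q : ℂ) (N : ℕ) (X Y : B) :
    onsagerRHS q N (rhoConst q 0 N) X Y = 0 := by
  have : ∀ k, rhoConst q 0 N k = 0 := fun k => by
    unfold rhoConst
    split <;> simp
  simp [onsagerRHS, this]

/-- The conditions on `q` under which the constants `γ` make sense. -/
def GammaDefined (q : ℂ) (N : ℕ) : Prop :=
  (N = 3 → q ^ 4 + 2 * q ^ 2 + 4 + 2 * q⁻¹ ^ 2 + q⁻¹ ^ 4 ≠ 0) ∧
    (N = 4 → q ^ 4 + q⁻¹ ^ 4 + 3 ≠ 0)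

lemma GammaDefined.inv {q : ℂ} {N : ℕ} (h : GammaDefined q N) : GammaDefined q⁻¹ N := by
  refine ⟨fun hN h0 => h.1 hN ?_, fun hN h0 => h.2 hN ?_⟩ <;> rw [← h0, inv_inv] <;> ring

/-- The denominator of `γ` is a factor of `ρ ^ 0`, so the actual coefficient is a Laurent polynomial
in `q`. -/
lemma rhoConst_three_mul_gammaConst {q : ℂ} (h : GammaDefined q 3) (x : ℂ) :
    rhoConst q x 3 0 * gammaConst q 3 0 1 =
      x * ((q + q⁻¹) * (q ^ 2 + q⁻¹ ^ 2) * (q ^ 2 + 3 + q⁻¹ ^ 2)) := by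
  rw [rhoConst, gammaConst, mul_assoc, mul_div_cancel₀ _ (h.1 rfl)]

lemma rhoConst_four_mul_gammaConst {q : ℂ} (h : GammaDefined q 4) (x : ℂ) :
    rhoConst q x 4 0 * (qNum q 3 * qNum q 5 / (q ^ 4 + q⁻¹ ^ 4 + 3)) =
      x * ((q + q⁻¹) ^ 2 * (qNum q 3 * qNum q 5)) := by
  have := h.2 rfl
  rw [rhoConst, show q ^ 4 + 3 + q⁻¹ ^ 4 = q ^ 4 + q⁻¹ ^ 4 + 3 by ring, mul_assoc,
    mul_div_cancel₀ _ this, mul_assoc]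

/-- Left and right multiplication by `X` commute, so both sides are combinations of the words `X ^ r
* Y * X ^ s`, and comparing scalars for each `N ≤ 4` suffices. The structure constants are exactly
those produced by the `θ`-terms. -/
lemma serreSeq_eq {q θ x : ℂ} (hq0 : q ≠ 0) (hq : ∀ m : ℕ, 0 < m → q ^ m ≠ 1) {N : ℕ}
    (hN : N ≤ 4) (hγ : GammaDefined q N) {w : ℂ} (hw : w * q ^ N = 1)
    (hx : x = θ * (q - q⁻¹) ^ 2) (X Y : B) :
    serreSeq q w θ X Y (N + 2) =
      qSerre q (N + 1) X Y - onsagerRHS q N (rhoConst q x N) X Y := by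
  have hne := sub_inv_ne_zero hq0 hq
  have n2 : qNum q 2 = q + q⁻¹ := by rw [qNum_eq_iff hne]; ring
  have n3 : qNum q 3 = q ^ 2 + 1 + q⁻¹ ^ 2 := by rw [qNum_eq_iff hne]; field_simp; ring
  have n4 : qNum q 4 = (q + q⁻¹) * (q ^ 2 + q⁻¹ ^ 2) := by
    rw [qNum_eq_iff hne]; field_simp; ring
  have n5 : qNum q 5 = q ^ 4 + q ^ 2 + 1 + q⁻¹ ^ 2 + q⁻¹ ^ 4 := by
    rw [qNum_eq_iff hne]; field_simp; ring
  have hw' : w = q⁻¹ ^ N := by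
    rw [eq_comm, inv_pow, inv_eq_iff_eq_inv, eq_comm]; exact inv_eq_of_mul_eq_one_right hw
  have n2' : q + q⁻¹ ≠ 0 := n2 ▸ qNum_ne_zero hq0 hq two_pos
  have b21 : qBinom q 2 1 = q + q⁻¹ := by rw [qBinom_one_right hq0 hq, n2]
  have b31 : qBinom q 3 1 = q ^ 2 + 1 + q⁻¹ ^ 2 := by rw [qBinom_one_right hq0 hq, n3]
  have b32 : qBinom q 3 2 = q ^ 2 + 1 + q⁻¹ ^ 2 := by
    rw [← b31, ← qBinom_symm q (by norm_num : 1 ≤ 3)]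
  have b41 : qBinom q 4 1 = (q + q⁻¹) * (q ^ 2 + q⁻¹ ^ 2) := by rw [qBinom_one_right hq0 hq, n4]
  have b43 : qBinom q 4 3 = (q + q⁻¹) * (q ^ 2 + q⁻¹ ^ 2) := by
    rw [← b41, ← qBinom_symm q (by norm_num : 1 ≤ 4)]
  have b42 : qBinom q 4 2 = (q ^ 2 + 1 + q⁻¹ ^ 2) * (q ^ 2 + q⁻¹ ^ 2) := by
    rw [qBinom_two_right hq0 hq, n4, n3, n2, div_eq_iff n2']; ring
  have b51 : qBinom q 5 1 = q ^ 4 + q ^ 2 + 1 + q⁻¹ ^ 2 + q⁻¹ ^ 4 := by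
    rw [qBinom_one_right hq0 hq, n5]
  have b54 : qBinom q 5 4 = q ^ 4 + q ^ 2 + 1 + q⁻¹ ^ 2 + q⁻¹ ^ 4 := by
    rw [← b51, ← qBinom_symm q (by norm_num : 1 ≤ 5)]
  have b52 : qBinom q 5 2 = (q ^ 4 + q ^ 2 + 1 + q⁻¹ ^ 2 + q⁻¹ ^ 4) * (q ^ 2 + q⁻¹ ^ 2) := by
    rw [qBinom_two_right hq0 hq, n5, n4, n2, div_eq_iff n2']; ring
  have b53 : qBinom q 5 3 = (q ^ 4 + q ^ 2 + 1 + q⁻¹ ^ 2 + q⁻¹ ^ 4) * (q ^ 2 + q⁻¹ ^ 2) := by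
    rw [← b52, ← qBinom_symm q (by norm_num : 2 ≤ 5)]
  have b0 := qBinom_zero_right hq0 hq
  have bs := qBinom_self hq0 hq
  -- The words become opaque symbols, on which multiplication by `X` only shifts an index; this
  -- prepares `match_scalars`.
  obtain ⟨W, hW⟩ : ∃ W : ℕ → ℕ → B, ∀ r s, X ^ r * Y * X ^ s = W r s := ⟨_, fun _ _ => rfl⟩
  have hY : Y = W 0 0 := by rw [← hW]; simp
  have hl : ∀ r s, X * W r s = W (r + 1) s := fun r s => by
    rw [← hW, ← hW, pow_succ']; simp only [mul_assoc]
  have hr : ∀ r s, W r s * X = W r (s + 1) := fun r s => by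
    rw [← hW, ← hW, pow_succ]; simp only [mul_assoc]
  subst hx hw'
  simp only [qSerre, onsagerRHS, hW]
  rw [hY]
  clear hY hW
  interval_cases N
  · simp [serreSeq, Finset.sum_range_succ, b0, bs, hl, hr, sub_eq_add_neg]
  · simp only [serreSeq, Finset.sum_range_succ, Finset.range_zero, Finset.sum_empty, b0, bs,
      b21, hl, hr, mul_add, mul_sub, sub_mul, mul_smul_comm, smul_mul_assoc, chainCoeff,
      Nat.reduceAdd, Nat.reduceDiv, Nat.reduceMul, Nat.reduceSub, gammaConst, rhoConst]
    match_scalars <;> field_simp <;> ring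
  · simp only [serreSeq, Finset.sum_range_succ, Finset.range_zero, Finset.sum_empty, b0, bs,
      b31, b32, hl, hr, mul_add, mul_sub, add_mul, sub_mul, mul_smul_comm, smul_mul_assoc,
      chainCoeff, Nat.reduceAdd, Nat.reduceDiv, Nat.reduceMul, Nat.reduceSub, gammaConst, rhoConst]
    match_scalars <;> field_simp <;> ring
  · have hg := rhoConst_three_mul_gammaConst hγ (θ * (q - q⁻¹) ^ 2)
    have hR : ∑ k ∈ Finset.range ((3 + 1) / 2), rhoConst q (θ * (q - q⁻¹) ^ 2) 3 k •
        ∑ l ∈ Finset.range (3 - 2 * k), ((-1) ^ l * gammaConst q 3 k l) •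
          W (3 - 1 - 2 * k - l) l =
        rhoConst q (θ * (q - q⁻¹) ^ 2) 3 0 • (W 2 0 + W 0 2) -
          (θ * (q - q⁻¹) ^ 2 * ((q + q⁻¹) * (q ^ 2 + q⁻¹ ^ 2) * (q ^ 2 + 3 + q⁻¹ ^ 2))) • W 1 1 +
          rhoConst q (θ * (q - q⁻¹) ^ 2) 3 1 • W 0 0 := by
      rw [← hg]
      simp only [Finset.sum_range_succ, Finset.range_zero, Finset.sum_empty, Nat.reduceAdd,
        Nat.reduceDiv, Nat.reduceMul, Nat.reduceSub, show gammaConst q 3 0 0 = 1 from rfl,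
        show gammaConst q 3 0 2 = 1 from rfl, show gammaConst q 3 1 0 = 1 from rfl]
      module
    rw [hR]
    simp only [serreSeq, Finset.sum_range_succ, Finset.range_zero, Finset.sum_empty, b0, bs,
      b41, b42, b43, hl, hr, mul_add, mul_sub, add_mul, sub_mul, mul_smul_comm, smul_mul_assoc,
      chainCoeff, Nat.reduceAdd, Nat.reduceMul, Nat.reduceSub, rhoConst]
    match_scalars <;> field_simp <;> ring
  · have hg := rhoConst_four_mul_gammaConst hγ (θ * (q - q⁻¹) ^ 2)
    have hR : ∑ k ∈ Finset.range ((4 + 1) / 2), rhoConst q (θ * (q - q⁻¹) ^ 2) 4 k •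
        ∑ l ∈ Finset.range (4 - 2 * k), ((-1) ^ l * gammaConst q 4 k l) •
          W (4 - 1 - 2 * k - l) l =
        rhoConst q (θ * (q - q⁻¹) ^ 2) 4 0 • (W 3 0 - W 0 3) -
          (θ * (q - q⁻¹) ^ 2 * ((q + q⁻¹) ^ 2 * (qNum q 3 * qNum q 5))) • (W 2 1 - W 1 2) +
          rhoConst q (θ * (q - q⁻¹) ^ 2) 4 1 • (W 1 0 - W 0 1) := by
      rw [← hg]
      simp only [Finset.sum_range_succ, Finset.range_zero, Finset.sum_empty, Nat.reduceAdd,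
        Nat.reduceDiv, Nat.reduceMul, Nat.reduceSub, show gammaConst q 4 0 0 = 1 from rfl,
        show gammaConst q 4 0 3 = 1 from rfl, show gammaConst q 4 1 0 = 1 from rfl,
        show gammaConst q 4 1 1 = 1 from rfl,
        show gammaConst q 4 0 1 = qNum q 3 * qNum q 5 / (q ^ 4 + q⁻¹ ^ 4 + 3) from rfl,
        show gammaConst q 4 0 2 = qNum q 3 * qNum q 5 / (q ^ 4 + q⁻¹ ^ 4 + 3) from rfl]
      module
    rw [hR, n3, n5]
    simp only [serreSeq, Finset.sum_range_succ, Finset.range_zero, Finset.sum_empty, b0, bs,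
      b51, b52, b53, b54, hl, hr, mul_add, mul_sub, add_mul, sub_mul, mul_smul_comm,
      smul_mul_assoc, chainCoeff, Nat.reduceAdd, Nat.reduceMul, Nat.reduceSub, rhoConst]
    match_scalars <;> field_simp <;> ring

lemma IsSerreChain.relation {q w θ x : ℂ} (hq0 : q ≠ 0) (hq : ∀ m : ℕ, 0 < m → q ^ m ≠ 1) {N : ℕ}
    (hN : N ≤ 4) (hγ : GammaDefined q N) (hw : w * q ^ N = 1) (hx : x = θ * (q - q⁻¹) ^ 2)
    {X : B} {z : ℕ → B} (h : IsSerreChain q w θ N X z) :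
    qSerre q (N + 1) X (z 1) = onsagerRHS q N (rhoConst q x N) X (z 1) := by
  rw [← sub_eq_zero, ← serreSeq_eq hq0 hq hN hγ hw hx, h.serreSeq_eq_zero hw]

lemma isSerreChain_of_relation {q w θ x : ℂ} (hq0 : q ≠ 0) (hq : ∀ m : ℕ, 0 < m → q ^ m ≠ 1)
    {N : ℕ} (hN : N ≤ 4) (hγ : GammaDefined q N) (hw : w * q ^ N = 1)
    (hx : x = θ * (q - q⁻¹) ^ 2) {X Y : B}
    (h : qSerre q (N + 1) X Y = onsagerRHS q N (rhoConst q x N) X Y) :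
    IsSerreChain q w θ N X (chainSeq q w θ X Y) :=
  isSerreChain_chainSeq hw hq <| by rw [serreSeq_eq hq0 hq hN hγ hw hx, h, sub_self]

lemma IsSerreChain.qSerre_eq_zero {q w : ℂ} (hq0 : q ≠ 0) (hq : ∀ m : ℕ, 0 < m → q ^ m ≠ 1) {N : ℕ}
    (hN : N ≤ 4) (hγ : GammaDefined q N) (hw : w * q ^ N = 1)
    {X : B} {z : ℕ → B} (h : IsSerreChain q w 0 N X z) :
    qSerre q (N + 1) X (z 1) = 0 := by
  rw [h.relation hq0 hq hN hγ hw (x := 0) (by simp), onsagerRHS_rhoConst_zero]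

lemma isSerreChain_of_qSerre_eq_zero {q w : ℂ} (hq0 : q ≠ 0)
    (hq : ∀ m : ℕ, 0 < m → q ^ m ≠ 1) {N : ℕ} (hN : N ≤ 4) (hγ : GammaDefined q N)
    (hw : w * q ^ N = 1) {X Y : B} (h : qSerre q (N + 1) X Y = 0) :
    IsSerreChain q w 0 N X (chainSeq q w 0 X Y) :=
  isSerreChain_of_relation hq0 hq hN hγ hw (x := 0) (by simp) <| by
    rw [h, onsagerRHS_rhoConst_zero]

end QNumbers

/-! ### `sl_2`-type relations: strings, divided powers and convolutions. -/

section Ladder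

variable {B : Type*} [Ring B] [Algebra ℂ B]

/-- The relations between `E = c e k`, `F = c̄ f k` and `K = k ^ 2` in `U_q(sl_2)`, where
`θ = c c̄ / (q - q⁻¹) ^ 2`. -/
structure IsLadder (q θ : ℂ) (E F K : B) : Prop where
  K_E : K * E = q ^ 2 • (E * K)
  F_K : F * K = q ^ 2 • (K * F)
  F_E : F * E = q ^ 2 • (E * F) - (θ * (q ^ 2 - 1)) • (K ^ 2 - 1)

/-- The relations are symmetric in raising and lowering up to inverting `q`, with the same `θ`; this
transfers the `e_j` case to `f_j`. -/
lemma IsLadder.symm {q θ : ℂ} {E F K : B} (hq0 : q ≠ 0) (h : IsLadder q θ E F K) :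
    IsLadder q⁻¹ θ F E K := by
  refine ⟨?_, ?_, ?_⟩
  · rw [h.F_K, smul_smul, ← mul_pow, inv_mul_cancel₀ hq0, one_pow, one_smul]
  · rw [h.K_E, smul_smul, ← mul_pow, inv_mul_cancel₀ hq0, one_pow, one_smul]
  · have : q⁻¹ ^ 2 * q ^ 2 = 1 := by rw [← mul_pow, inv_mul_cancel₀ hq0, one_pow]
    rw [h.F_E, smul_sub, smul_smul, smul_smul, this, one_smul, sub_sub, eq_comm, sub_eq_self,
      ← add_smul, show q⁻¹ ^ 2 * (θ * (q ^ 2 - 1)) + θ * (q⁻¹ ^ 2 - 1) = 0 by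
        linear_combination θ * this, zero_smul]

/-- The first elements of a lowest weight string satisfy the expected relation with `F`. -/
lemma IsLadder.lower_string {q w θ : ℂ} {N : ℕ} {E F K : B} {y : ℕ → B} (h : IsLadder q θ E F K)
    (hc : ∀ k < N, chainCoeff q w k ≠ 0) (hy : IsSerreChain q w 0 N E y)
    (hK : ∀ k, K * y (k + 1) = (q ^ (2 * k) * w) • (y (k + 1) * K))
    (hF : F * y 1 = w • (y 1 * F)) (k : ℕ) (hk : k ≤ N) :
    F * y (k + 1) = (q ^ (2 * k) * w) • (y (k + 1) * F) - θ • y k := by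
  induction k with
  | zero => simp [hF, hy.zero]
  | succ k ih =>
    have ih := ih (by omega)
    apply smul_right_injective B (hc k (by omega))
    -- This is the preceding step of the recursion; at `k = 0` both sides vanish because `y 0 = 0`
    -- and `1 - q ^ 0 = 0`.
    have hE : (q ^ 2) • (E * y k) - (q ^ (2 * k) * w) • (y k * E) =
        ((1 - q ^ (2 * k)) * (q ^ 2 - q ^ (2 * k) * w ^ 2)) • y (k + 1) := by
      cases k with
      | zero => simp [hy.zero]
      | succ k =>
        have := hy.step k (by omega)
        rw [zero_smul, add_zero] at this
        rw [show (1 - q ^ (2 * (k + 1))) * (q ^ 2 - q ^ (2 * (k + 1)) * w ^ 2) =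
          q ^ 2 * chainCoeff q w k by rw [chainCoeff]; ring, mul_smul _ _ (y (k + 1 + 1)), this]
        match_scalars <;> ring
    have hst := hy.step k (by omega)
    rw [zero_smul, add_zero] at hst
    have hKK : K ^ 2 * y (k + 1) = ((q ^ (2 * k) * w) ^ 2) • (y (k + 1) * K ^ 2) := by
      rw [pow_two K, mul_assoc, hK, mul_smul_comm, ← mul_assoc, hK, smul_mul_assoc, smul_smul,
        mul_assoc (y _), ← pow_two (_ * w), ← pow_two]
    have h1 : F * (E * y (k + 1)) = (q ^ 2 * (q ^ (2 * k) * w)) • (E * y (k + 1) * F)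
        - (θ * q ^ 2) • (E * y k) - (θ * (q ^ 2 - 1)) • (((q ^ (2 * k) * w) ^ 2) •
        (y (k + 1) * K ^ 2) - y (k + 1)) := by
      rw [← mul_assoc, h.F_E, sub_mul, smul_mul_assoc, smul_mul_assoc, sub_mul, hKK, one_mul,
        mul_assoc, ih, mul_sub, mul_smul_comm, mul_smul_comm, ← mul_assoc]
      module
    have h2 : F * (y (k + 1) * E) = (q ^ (2 * k) * w) • (q ^ 2 • (y (k + 1) * E * F) -
        (θ * (q ^ 2 - 1)) • (y (k + 1) * K ^ 2 - y (k + 1))) - θ • (y k * E) := by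
      rw [← mul_assoc, ih, sub_mul, smul_mul_assoc, smul_mul_assoc, mul_assoc, h.F_E, mul_sub,
        mul_smul_comm, mul_smul_comm, mul_sub _ (K ^ 2), mul_one, mul_assoc]
    show chainCoeff q w k • (F * y (k + 2)) = chainCoeff q w k • ((q ^ (2 * (k + 1)) * w) •
      (y (k + 2) * F) - θ • y (k + 1))
    have hyF := congrArg (· * F) hst
    simp only [smul_mul_assoc, sub_mul] at hyF
    rw [← mul_smul_comm, hst, smul_sub, smul_comm _ _ (y (k + 2) * F), hyF, mul_sub,
      mul_smul_comm, h1, h2, ← sub_eq_zero]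
    -- In `h1` minus `q ^ (2 * k) * w` times `h2` the `K ^ 2` terms cancel. What remains of `K ^ 2 -
    -- 1` is the scalar by which two consecutive chain coefficients, suitably scaled, differ.
    have : (1 - q ^ (2 * k)) * (q ^ 2 - q ^ (2 * k) * w ^ 2) =
        chainCoeff q w k + (q ^ 2 - 1) * (1 - (q ^ (2 * k) * w) ^ 2) := by
      rw [chainCoeff]; ring
    rw [this] at hE
    calc _ = -θ • ((q ^ 2) • (E * y k) - (q ^ (2 * k) * w) • (y k * E) -
          (chainCoeff q w k + (q ^ 2 - 1) * (1 - (q ^ (2 * k) * w) ^ 2)) • y (k + 1)) := by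
            match_scalars <;> ring
      _ = 0 := by rw [hE, sub_self, smul_zero]

/-- If `y` is a lowest weight string for `E, F, K`, then it is a chain for `E + F + K A`. -/
lemma IsLadder.isSerreChain_string {q w θ : ℂ} {N : ℕ} {E F K A : B} {y : ℕ → B}
    (h : IsLadder q θ E F K)
    (hc : ∀ k < N, chainCoeff q w k ≠ 0) (hy : IsSerreChain q w 0 N E y)
    (hK : ∀ k, K * y (k + 1) = (q ^ (2 * k) * w) • (y (k + 1) * K))
    (hF : F * y 1 = w • (y 1 * F)) (hA : ∀ k, Commute A (y k)) :
    IsSerreChain q w θ N (E + (F + K * A)) y := by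
  refine hy.add_semiconj fun k hk => ?_
  rw [add_mul, h.lower_string hc hy hK hF k hk, mul_assoc, (hA _).eq, ← mul_assoc, hK,
    smul_mul_assoc, mul_add, ← mul_assoc]
  module

/-- The divided powers `E ^ m / ((1 - q ^ 2) ⋯ (1 - q ^ (2 m)))`, with index shifted by one. -/
noncomputable def divPow (q : ℂ) (E : B) : ℕ → B
  | 0 => 0
  | 1 => 1
  | m + 2 => (1 - q ^ (2 * m + 2))⁻¹ • (E * divPow q E (m + 1))

lemma mul_divPow {q : ℂ} (hq : ∀ m : ℕ, 0 < m → q ^ m ≠ 1) (E : B) (m : ℕ) :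
    E * divPow q E (m + 1) = (1 - q ^ (2 * m + 2)) • divPow q E (m + 2) := by
  rw [divPow, smul_inv_smul₀ (sub_ne_zero.2 (hq _ (by omega)).symm)]

lemma commute_divPow (q : ℂ) (E : B) : ∀ m, Commute E (divPow q E m)
  | 0 => Commute.zero_right E
  | 1 => Commute.one_right E
  | m + 2 => by
    rw [divPow]
    exact ((Commute.refl E).mul_right (commute_divPow q E (m + 1))).smul_right _

lemma IsLadder.K_divPow {q θ : ℂ} {E F K : B} (h : IsLadder q θ E F K) (m : ℕ) :
    K * divPow q E (m + 1) = q ^ (2 * m) • (divPow q E (m + 1) * K) := by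
  induction m with
  | zero => simp [divPow]
  | succ m ih =>
    rw [divPow, mul_smul_comm, ← mul_assoc, h.K_E, smul_mul_assoc, mul_assoc, ih, mul_smul_comm,
      smul_mul_assoc, mul_assoc, smul_smul, smul_smul, smul_smul]
    congr 1; ring

/-- The `q`-analogue of commuting `f` past a divided power: the normalization makes the correction a
multiple of the preceding divided power with a Cartan factor. -/
lemma IsLadder.F_divPow {q θ : ℂ} {E F K : B} (hq0 : q ≠ 0) (hq : ∀ m : ℕ, 0 < m → q ^ m ≠ 1)
    (h : IsLadder q θ E F K) (m : ℕ) :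
    F * divPow q E (m + 1) = q ^ (2 * m) • (divPow q E (m + 1) * F) +
      θ • ((q ^ (2 * m) * q⁻¹ ^ 2) • (divPow q E m * K ^ 2) - divPow q E m) := by
  induction m with
  | zero => simp [divPow]
  | succ m ih =>
    apply smul_right_injective B (sub_ne_zero.2 (hq (2 * m + 2) (by omega)).symm)
    have hE : E * divPow q E m = (1 - q ^ (2 * m)) • divPow q E (m + 1) := by
      cases m with
      | zero => simp [divPow]
      | succ m => exact mul_divPow hq E m
    have hKK : K ^ 2 * divPow q E (m + 1) =
        ((q ^ (2 * m)) ^ 2) • (divPow q E (m + 1) * K ^ 2) := by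
      rw [pow_two, mul_assoc, h.K_divPow, mul_smul_comm, ← mul_assoc, h.K_divPow, smul_mul_assoc,
        smul_smul, mul_assoc, ← pow_two]
    show (1 - q ^ (2 * m + 2)) • (F * divPow q E (m + 2)) =
      (1 - q ^ (2 * m + 2)) • (_ • (divPow q E (m + 2) * F) + _)
    rw [← mul_smul_comm, ← mul_divPow hq, ← mul_assoc, h.F_E, sub_mul, smul_mul_assoc,
      smul_mul_assoc, sub_mul, hKK, one_mul, mul_assoc, ih, mul_add, mul_smul_comm, mul_smul_comm,
      mul_sub, mul_smul_comm, ← mul_assoc, ← mul_assoc, hE, mul_divPow hq]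
    simp only [smul_mul_assoc]
    match_scalars <;> field_simp <;> ring

/-- The chain for `E + F + K A` built from a chain for `A`. -/
noncomputable def ladderSum (q : ℂ) (E : B) (v : ℕ → B) : ℕ → B
  | 0 => 0
  | k + 1 => ∑ p ∈ Finset.HasAntidiagonal.antidiagonal k, divPow q E (p.1 + 1) * v p.2

lemma ladderSum_eq (q : ℂ) (E : B) (v : ℕ → B) (k : ℕ) :
    ladderSum q E v k = ∑ p ∈ Finset.HasAntidiagonal.antidiagonal k, divPow q E p.1 * v p.2 := by
  cases k with
  | zero => simp [ladderSum, divPow]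
  | succ k => rw [Finset.Nat.sum_antidiagonal_succ, ladderSum]; simp [divPow]

/-- For `m + l = k + 1` the coefficient splits into a part vanishing at `m = 0` and a part vanishing
at `l = 0`. Shifting each index separately yields the contributions of raising by `E` and of
advancing in the chain of `A`. -/
lemma chainCoeff_smul_ladderSum {q w : ℂ} (hq0 : q ≠ 0) (E : B) (v : ℕ → B) (k : ℕ) :
    chainCoeff q w k • ladderSum q E v (k + 2) = ∑ p ∈ Finset.HasAntidiagonal.antidiagonal k,
      (((1 - q ^ (2 * p.1 + 2)) * (1 - q ^ (2 * p.1 + 4 * p.2) * w ^ 2)) •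
        (divPow q E (p.1 + 2) * v p.2) +
      (q ^ (2 * p.1) * chainCoeff q w p.2) • (divPow q E (p.1 + 1) * v (p.2 + 1))) := by
  have : chainCoeff q w k • ladderSum q E v (k + 2) =
      ∑ p ∈ Finset.HasAntidiagonal.antidiagonal (k + 1),
      (((1 - q ^ (2 * p.1)) * (1 - q ^ (2 * p.1 + 4 * p.2) * q⁻¹ ^ 2 * w ^ 2)) •
        (divPow q E (p.1 + 1) * v p.2)) + ∑ p ∈ Finset.HasAntidiagonal.antidiagonal (k + 1),
      ((q ^ (2 * p.1) * ((1 - q ^ (2 * p.2)) * (1 - q ^ (2 * p.2) * q⁻¹ ^ 2 * w ^ 2))) •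
        (divPow q E (p.1 + 1) * v p.2)) := by
    rw [← Finset.sum_add_distrib, ladderSum, Finset.smul_sum]
    refine Finset.sum_congr rfl fun p hp => ?_
    rw [← add_smul]
    congr 1
    have hk : q ^ (2 * k) = q ^ (2 * p.1) * q ^ (2 * p.2) * q⁻¹ ^ 2 := by
      rw [← pow_add, ← mul_add, Finset.HasAntidiagonal.mem_antidiagonal.1 hp, mul_add, pow_add,
        mul_assoc,
        mul_one, ← mul_pow, mul_inv_cancel₀ hq0, one_pow, mul_one]
    rw [chainCoeff, pow_add, hk]
    field_simp
    ring
  rw [this, Finset.Nat.sum_antidiagonal_succ, Finset.Nat.sum_antidiagonal_succ',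
    Finset.sum_add_distrib]
  simp only [mul_zero, pow_zero, sub_self, zero_mul, zero_smul, zero_add, chainCoeff]
  congr 1
  · refine Finset.sum_congr rfl fun p _ => ?_
    congr 1
    field_simp
    ring
  · refine Finset.sum_congr rfl fun p _ => ?_
    congr 1
    field_simp
    ring

/-- Termwise, `E` raises the divided power, `F` lowers it, and `K A` moves along the chain `a` in
both directions. The raising terms combine by `chainCoeff_smul_ladderSum`; of the lowering terms,
those with an extra Cartan factor cancel and the rest sum to `θ z k`. -/
lemma IsLadder.isSerreChain_tensor {q w θ : ℂ} {N : ℕ} {E F K A J : B} {a : ℕ → B}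
    (hq0 : q ≠ 0) (hq : ∀ m : ℕ, 0 < m → q ^ m ≠ 1) (h : IsLadder q θ E F K)
    (ha : IsSerreChain q w θ N A a) (hJE : J * E = w • (E * J)) (hJF : F * J = w • (J * F))
    (hJK : Commute J K) (hAE : Commute A E) (hAK : Commute A K) (hAJ : Commute A J)
    (haE : ∀ k, Commute (a k) E) (haF : ∀ k, Commute (a k) F) (haK : ∀ k, Commute (a k) K) :
    IsSerreChain q w θ N (E + F + K * A)
      (ladderSum q E fun l => K ^ l * J * a (l + 1)) := by
  obtain ⟨v, hv'⟩ : ∃ v : ℕ → B, v = fun l => K ^ l * J * a (l + 1) := ⟨_, rfl⟩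
  -- The lowering terms with an extra Cartan factor: `K ^ 2 * v l` from `F`, and `u l` from the
  -- `θ`-term of the chain `a`.
  obtain ⟨u, hu⟩ : ∃ u : ℕ → B, ∀ l, u l = K ^ (l + 1) * J * a l := ⟨_, fun _ => rfl⟩
  have hv : ∀ l, v l = K ^ l * J * a (l + 1) := fun l => by rw [hv']
  rw [← hv']
  have hu0 : u 0 = 0 := by simp [hu, ha.zero]
  have hu1 : ∀ l, K ^ 2 * v l = u (l + 1) := fun l => by
    simp only [hu, hv, ← mul_assoc, ← pow_add, add_comm 2]
  have hKE : ∀ l : ℕ, K ^ l * E = q ^ (2 * l) • (E * K ^ l) := fun l => by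
    induction l with
    | zero => simp
    | succ l ih =>
      rw [pow_succ', mul_assoc, ih, mul_smul_comm, ← mul_assoc, h.K_E, smul_mul_assoc, smul_smul,
        mul_assoc, mul_add, pow_add, mul_one]
  have hFK : ∀ l : ℕ, F * K ^ l = q ^ (2 * l) • (K ^ l * F) := fun l => by
    induction l with
    | zero => simp
    | succ l ih =>
      rw [pow_succ, ← mul_assoc, ih, smul_mul_assoc, mul_assoc, h.F_K, mul_smul_comm, smul_smul,
        mul_assoc, mul_add, pow_add, mul_one]
  have hvE : ∀ l, v l * E = (q ^ (2 * l) * w) • (E * v l) := fun l => by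
    simp only [hv]
    rw [mul_assoc, (haE _).eq, ← mul_assoc, mul_assoc (K ^ l), hJE, mul_smul_comm, ← mul_assoc,
      hKE]
    simp only [smul_mul_assoc, smul_smul, mul_assoc, mul_comm w]
  have hvF : ∀ l, F * v l = (q ^ (2 * l) * w) • (v l * F) := fun l => by
    simp only [hv]
    rw [mul_assoc _ _ F, (haF _).eq, ← mul_assoc, ← mul_assoc F, hFK, smul_mul_assoc,
      mul_assoc _ F, hJF]
    simp only [smul_mul_assoc, mul_smul_comm, smul_smul, mul_assoc]
  have hvA : ∀ l ≤ N, K * A * v l - (q ^ (2 * l) * w) • (v l * (K * A)) =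
      chainCoeff q w l • v (l + 1) - θ • u l := fun l hl => by
    have h1 : K * A * v l = K ^ (l + 1) * J * (A * a (l + 1)) := by
      have := ((hAK.pow_right l).mul_right hAJ).eq
      simp only [hv]
      rw [mul_assoc K, ← mul_assoc A, this, mul_assoc _ A, ← mul_assoc, ← mul_assoc K,
        ← pow_succ', mul_assoc]
    have h2 : v l * (K * A) = K ^ (l + 1) * J * (a (l + 1) * A) := by
      simp only [hv]
      rw [← mul_assoc, mul_assoc (K ^ l * J), (haK _).eq, ← mul_assoc, mul_assoc (K ^ l), hJK.eq,
        ← mul_assoc, ← pow_succ, mul_assoc]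
    rw [h1, h2, ← mul_smul_comm, ← mul_sub, ← sub_eq_of_eq_add (ha.step l hl), mul_sub]
    simp only [mul_smul_comm, hv, hu]
  refine ⟨by rw [ladderSum], fun k hk => ?_⟩
  have hterm : ∀ p ∈ Finset.HasAntidiagonal.antidiagonal k,
      (E + F + K * A) * (divPow q E (p.1 + 1) * v p.2) -
        (q ^ (2 * k) * w) • (divPow q E (p.1 + 1) * v p.2 * (E + F + K * A)) =
      (((1 - q ^ (2 * p.1 + 2)) * (1 - q ^ (2 * p.1 + 4 * p.2) * w ^ 2)) •
        (divPow q E (p.1 + 2) * v p.2) +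
      (q ^ (2 * p.1) * chainCoeff q w p.2) • (divPow q E (p.1 + 1) * v (p.2 + 1))) -
      θ • (divPow q E p.1 * v p.2) +
      θ • ((q ^ (2 * p.1) * q⁻¹ ^ 2) • (divPow q E p.1 * u (p.2 + 1)) -
        q ^ (2 * p.1) • (divPow q E (p.1 + 1) * u p.2)) := by
    rintro ⟨m, l⟩ hp
    obtain rfl : m + l = k := Finset.HasAntidiagonal.mem_antidiagonal.1 hp
    dsimp only
    have e1 : E * (divPow q E (m + 1) * v l) =
        (1 - q ^ (2 * m + 2)) • (divPow q E (m + 2) * v l) := by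
      rw [← mul_assoc, mul_divPow hq, smul_mul_assoc]
    have e2 : divPow q E (m + 1) * v l * E =
        (q ^ (2 * l) * w * (1 - q ^ (2 * m + 2))) • (divPow q E (m + 2) * v l) := by
      rw [mul_assoc, hvE, mul_smul_comm, ← mul_assoc, ← (commute_divPow q E _).eq, mul_assoc, e1,
        smul_smul]
    have e3 : F * (divPow q E (m + 1) * v l) =
        (q ^ (2 * m) * (q ^ (2 * l) * w)) • (divPow q E (m + 1) * v l * F) +
        θ • ((q ^ (2 * m) * q⁻¹ ^ 2) • (divPow q E m * u (l + 1)) - divPow q E m * v l) := by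
      rw [← mul_assoc, h.F_divPow hq0 hq, add_mul, smul_mul_assoc, mul_assoc, hvF, smul_mul_assoc,
        sub_mul, smul_mul_assoc, mul_assoc _ (K ^ 2), hu1, mul_smul_comm, smul_smul, mul_assoc]
    have e4 : K * A * (divPow q E (m + 1) * v l) =
        q ^ (2 * m) • (divPow q E (m + 1) * ((q ^ (2 * l) * w) • (v l * (K * A)) +
          (chainCoeff q w l • v (l + 1) - θ • u l))) := by
      have hAD : ∀ m, Commute A (divPow q E m) := fun m => by
        induction m using Nat.strong_induction_on with
        | _ m ih =>
        match m with
        | 0 => exact Commute.zero_right A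
        | 1 => exact Commute.one_right A
        | m + 2 =>
          rw [divPow]
          exact (hAE.mul_right (ih (m + 1) (by omega))).smul_right _
      have hl : l ≤ N := by omega
      rw [← hvA l hl, add_sub_cancel, ← mul_assoc, mul_assoc K A, (hAD _).eq, ← mul_assoc K,
        h.K_divPow, smul_mul_assoc, smul_mul_assoc]
      simp only [mul_assoc]
    rw [add_mul, add_mul, mul_add, mul_add (_ * v l), mul_add (_ * v l), e1, e2, e3, e4]
    simp only [mul_add, mul_sub, mul_smul_comm, mul_assoc]
    module
  -- The two families cancel after moving the index by one; the boundary terms vanish since `divPow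
  -- q E 0 = 0` and `u 0 = 0`.
  have hshift : ∑ p ∈ Finset.HasAntidiagonal.antidiagonal k,
      (q ^ (2 * p.1) * q⁻¹ ^ 2) • (divPow q E p.1 * u (p.2 + 1)) =
      ∑ p ∈ Finset.HasAntidiagonal.antidiagonal k,
        q ^ (2 * p.1) • (divPow q E (p.1 + 1) * u p.2) := by
    cases k with
    | zero => simp [divPow, hu0]
    | succ k =>
      rw [Finset.Nat.sum_antidiagonal_succ, Finset.Nat.sum_antidiagonal_succ', hu0]
      simp only [divPow, zero_mul, smul_zero, mul_zero, zero_add]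
      refine Finset.sum_congr rfl fun p _ => ?_
      congr 1
      field_simp
      ring
  have hsum := Finset.sum_congr (rfl : Finset.HasAntidiagonal.antidiagonal k = _) hterm
  rw [Finset.sum_sub_distrib, ← Finset.mul_sum, ← Finset.smul_sum, ← Finset.sum_mul,
    Finset.sum_add_distrib, Finset.sum_sub_distrib, ← chainCoeff_smul_ladderSum hq0,
    ← Finset.smul_sum, ← ladderSum_eq, ← Finset.smul_sum, Finset.sum_sub_distrib, hshift, sub_self,
    smul_zero, add_zero] at hsum
  rw [show ladderSum q E v (k + 1) = ∑ i ∈ Finset.HasAntidiagonal.antidiagonal k,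
    divPow q E (i.1 + 1) * v i.2 from rfl, hsum, sub_add_cancel]

end Ladder

/-! ### Compatibility of coproduct and coaction with the relations. -/

section SerrePairs

variable {U O : Type*} [Ring U] [Algebra ℂ U] [Ring O] [Algebra ℂ O]

/-- The relations between `x = e_i`, `y = e_j`, `k = k_i`, `l = k_j` and the inverses `k'`, `l'`
of `k`, `l` in a quantized enveloping algebra. -/
structure IsSerrePair (q β : ℂ) (N : ℕ) (x y k k' l l' : U) : Prop where
  k_k' : k * k' = 1
  k'_k : k' * k = 1
  l_l' : l * l' = 1
  l'_l : l' * l = 1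
  k_l : Commute k l
  k_x : k * x = q • (x * k)
  k_y : k * y = β • (y * k)
  l_x : l * x = β • (x * l)
  serre : qSerre q (N + 1) x y = 0

lemma inv_semiconj {k k' x : U} {c : ℂ} (hc : c ≠ 0) (h1 : k * k' = 1) (h2 : k' * k = 1)
    (h : k * x = c • (x * k)) : k' * x = c⁻¹ • (x * k') := by
  have : k' * (k * x) * k' = c • (k' * x * (k * k')) := by
    rw [h, mul_smul_comm, smul_mul_assoc]; simp only [mul_assoc]
  rw [h1, mul_one, ← mul_assoc, h2, one_mul] at this
  rw [this, inv_smul_smul₀ hc]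

lemma pow_semiconj {k x : U} {c : ℂ} (h : k * x = c • (x * k)) (m : ℕ) :
    k ^ m * x = c ^ m • (x * k ^ m) := by
  induction m with
  | zero => simp
  | succ m ih =>
    rw [pow_succ', mul_assoc, ih, mul_smul_comm, ← mul_assoc, h, smul_mul_assoc, smul_smul,
      mul_assoc, pow_succ]

lemma mul_semiconj {k l x : U} {c c' : ℂ} (h : k * x = c • (x * k)) (h' : l * x = c' • (x * l)) :
    k * l * x = (c * c') • (x * (k * l)) := by
  rw [mul_assoc, h', mul_smul_comm, ← mul_assoc, h, smul_mul_assoc, smul_smul, mul_assoc,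
    mul_comm c']

namespace IsSerrePair

variable {q β : ℂ} {N : ℕ} {x y k k' l l' : U}

lemma pow_mul_x (h : IsSerrePair q β N x y k k' l l') (m : ℕ) :
    k ^ m * l * x = (q ^ m * β) • (x * (k ^ m * l)) :=
  mul_semiconj (pow_semiconj h.k_x m) h.l_x

lemma pow_mul_x' (h : IsSerrePair q β N x y k k' l l') (hq : q ≠ 0) (hβ : β ≠ 0) (m : ℕ) :
    k' ^ m * l' * x = (q⁻¹ ^ m * β⁻¹) • (x * (k' ^ m * l')) :=
  mul_semiconj (pow_semiconj (inv_semiconj hq h.k_k' h.k'_k h.k_x) m)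
    (inv_semiconj hβ h.l_l' h.l'_l h.l_x)

lemma l'_k' (h : IsSerrePair q β N x y k k' l l') : Commute l' k' := by
  have h1 : k' * l = (1 : ℂ)⁻¹ • (l * k') :=
    inv_semiconj one_ne_zero h.k_k' h.k'_k (by rw [one_smul, h.k_l.eq])
  have h2 : l' * k' = (1 : ℂ)⁻¹ • (k' * l') :=
    inv_semiconj one_ne_zero h.l_l' h.l'_l (by rw [h1, inv_one, one_smul, one_smul])
  rw [commute_iff_eq, h2, inv_one, one_smul]

lemma isSerreChain (h : IsSerrePair q β N x y k k' l l') (hq0 : q ≠ 0)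
    (hq : ∀ m : ℕ, 0 < m → q ^ m ≠ 1) (hN : N ≤ 4) (hγ : GammaDefined q N)
    (hw : β ^ 2 * q ^ N = 1) : IsSerreChain q (β ^ 2) 0 N x (chainSeq q (β ^ 2) 0 x y) :=
  isSerreChain_of_qSerre_eq_zero hq0 hq hN hγ hw h.serre

lemma qSerre_add {q : ℂ} (m : ℕ) (x y y' : U) :
    qSerre q m x (y + y') = qSerre q m x y + qSerre q m x y' := by
  simp [qSerre, mul_add, add_mul, Finset.sum_add_distrib]

/-- The coproduct respects the `q`-Serre relations. -/
lemma qSerre_comul (h : IsSerrePair q β N x y k k' l l') (hq0 : q ≠ 0)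
    (hq : ∀ m : ℕ, 0 < m → q ^ m ≠ 1) (hN : N ≤ 4) (hγ : GammaDefined q N)
    (hw : β ^ 2 * q ^ N = 1) :
    qSerre q (N + 1) (x ⊗ₜ[ℂ] k' + k ⊗ₜ[ℂ] x) (y ⊗ₜ[ℂ] l' + l ⊗ₜ[ℂ] y) = 0 := by
  have hβ : β ≠ 0 := by rintro rfl; simp at hw
  have hq' : ∀ m : ℕ, 0 < m → q⁻¹ ^ m ≠ 1 := fun m hm h => hq m hm <| by
    rwa [inv_pow, inv_eq_one] at h
  have hw' : β⁻¹ ^ 2 * q⁻¹ ^ N = 1 := by rw [inv_pow, inv_pow, ← mul_inv, hw, inv_one]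
  rw [qSerre_add]
  -- Here `x ⊗ k'` drives the chain. Passing `k ⊗ x` across it gives `q ^ m * β` from each tensor
  -- factor, together the twist `q ^ (2 * m) * β ^ 2` needed with `θ = 0`.
  have h1 : qSerre q (N + 1) (x ⊗ₜ[ℂ] k' + k ⊗ₜ[ℂ] x) (y ⊗ₜ[ℂ] l') = 0 := by
    have hc := (h.isSerreChain hq0 hq hN hγ hw).map
      (Algebra.TensorProduct.includeLeft : U →ₐ[ℂ] U ⊗[ℂ] U)
    have ht := (hc.twist (E := x ⊗ₜ[ℂ] k') (τ := fun m => 1 ⊗ₜ[ℂ] (k' ^ m * l'))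
      (fun m => by simp [pow_succ', mul_assoc])
      (fun m => by
        simp [pow_succ, mul_assoc, h.l'_k'.eq])).add_semiconj (θ := 0) (G := k ⊗ₜ[ℂ] x)
      (fun m hm => by
        simp only [Algebra.TensorProduct.includeLeft_apply, Nat.add_sub_cancel,
          Algebra.TensorProduct.tmul_mul_tmul, mul_one, one_mul, zero_smul, sub_zero]
        rw [chainSeq_semiconj h.k_x h.k_y, h.pow_mul_x' hq0 hβ, TensorProduct.tmul_smul,
          ← TensorProduct.smul_tmul', smul_smul]
        congr 1
        simp only [inv_pow]
        field_simp
        ring)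
    have := ht.qSerre_eq_zero hq0 hq hN hγ hw
    simpa [chainSeq] using this
  -- Now `k ⊗ x` drives the chain and `x ⊗ k'` is passed across; the scalars are inverted, so the
  -- argument runs with `q⁻¹`.
  have h2 : qSerre q (N + 1) (x ⊗ₜ[ℂ] k' + k ⊗ₜ[ℂ] x) (l ⊗ₜ[ℂ] y) = 0 := by
    have hc := (isSerreChain_of_qSerre_eq_zero (inv_ne_zero hq0) hq' hN hγ.inv hw'
      ((qSerre_inv q _ x y).trans h.serre)).map
      (Algebra.TensorProduct.includeRight : U →ₐ[ℂ] U ⊗[ℂ] U)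
    have ht := (hc.twist (E := k ⊗ₜ[ℂ] x) (τ := fun m => (k ^ m * l) ⊗ₜ[ℂ] 1)
      (fun m => by simp [pow_succ', mul_assoc])
      (fun m => by
        simp [pow_succ, mul_assoc, h.k_l.symm.eq])).add_semiconj (θ := 0) (G := x ⊗ₜ[ℂ] k')
      (fun m hm => by
        simp only [Algebra.TensorProduct.includeRight_apply, Nat.add_sub_cancel,
          Algebra.TensorProduct.tmul_mul_tmul, mul_one, one_mul, zero_smul, sub_zero]
        rw [inv_semiconj (mul_ne_zero (pow_ne_zero m hq0) hβ) h.k_k' h.k'_k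
          (chainSeq_semiconj h.k_x h.k_y m), h.pow_mul_x, TensorProduct.tmul_smul,
          ← TensorProduct.smul_tmul', smul_smul]
        congr 1
        simp only [inv_pow]
        field_simp
        ring)
    have := ht.qSerre_eq_zero (inv_ne_zero hq0) hq' hN hγ.inv hw'
    rw [qSerre_inv, add_comm (k ⊗ₜ[ℂ] x)] at this
    simpa [chainSeq] using this
  rw [h1, h2, add_zero]

/-- The string generated by `y l` under `c x k`. -/
lemma exists_string (h : IsSerrePair q β N x y k k' l l') (hq0 : q ≠ 0)
    (hq : ∀ m : ℕ, 0 < m → q ^ m ≠ 1) (hN : N ≤ 4) (hγ : GammaDefined q N)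
    (hw : β ^ 2 * q ^ N = 1) (c : ℂ) : ∃ z : ℕ → U,
      IsSerreChain q (β ^ 2) 0 N (c • (x * k)) z ∧ z 1 = y * l ∧
      ∀ m, k ^ 2 * z (m + 1) = (q ^ (2 * m) * β ^ 2) • (z (m + 1) * k ^ 2) := by
  -- Moving `k` past the chain element on the left, or `x` past `k ^ m * l` on the right, costs the
  -- same scalar `q ^ m * β`; `γ` collects these scalars along with `c`.
  set γ : ℕ → ℂ := fun m => ∏ i ∈ Finset.range m, (c * (q ^ i * β)) with hγ'
  have hγs : ∀ m, γ (m + 1) = γ m * (c * (q ^ m * β)) := fun m => Finset.prod_range_succ _ _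
  refine ⟨_, (h.isSerreChain hq0 hq hN hγ hw).twist (E := c • (x * k))
    (τ := fun m => γ m • (k ^ m * l)) (fun m => ?_) (fun m => ?_), ?_, fun m => ?_⟩
  · rw [hγs, smul_mul_assoc, mul_smul_comm, mul_smul_comm, ← mul_assoc, mul_assoc x,
      chainSeq_semiconj h.k_x h.k_y]
    simp only [smul_mul_assoc, mul_smul_comm, smul_smul, pow_succ', mul_assoc]
    congr 1; ring
  · rw [hγs, mul_smul_comm, mul_smul_comm, ← mul_assoc, smul_mul_assoc, mul_assoc _ _ x,
      h.pow_mul_x]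
    simp only [smul_mul_assoc, mul_smul_comm, smul_smul, pow_succ, mul_assoc, h.k_l.symm.eq]
    congr 1; ring
  · simp [hγ', chainSeq]
  · have hk2 := pow_semiconj (chainSeq_semiconj (q := q) (w := β ^ 2) h.k_x h.k_y m) 2
    have hc : Commute (k ^ 2) (k ^ m * l) :=
      ((Commute.refl k).pow_pow 2 m).mul_right (h.k_l.pow_left 2)
    rw [Nat.add_sub_cancel, mul_smul_comm, mul_smul_comm, ← mul_assoc, hk2, smul_mul_assoc,
      mul_assoc, hc.eq]
    simp only [smul_mul_assoc, smul_smul, mul_assoc]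
    congr 1; ring

end IsSerrePair

lemma IsLadder.map {V : Type*} [Ring V] [Algebra ℂ V] {q θ : ℂ} {E F K : U}
    (h : IsLadder q θ E F K) (φ : U →ₐ[ℂ] V) : IsLadder q θ (φ E) (φ F) (φ K) := by
  refine ⟨?_, ?_, ?_⟩
  · simpa using congrArg φ h.K_E
  · simpa using congrArg φ h.F_K
  · simpa using congrArg φ h.F_E

/-- Multiplying by `k` on the right turns the commutator of `x` and `f` into a `q ^ 2`-commutator,
and `k' ^ 2 * k ^ 2 = 1` turns its value into a multiple of `k ^ 4 - 1`. -/
lemma isLadder_of_sl2 {q : ℂ} (hq0 : q ≠ 0) {x f k k' : U}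
    (hk : k' * k = 1) (hx : k * x = q • (x * k)) (hf : k * f = q⁻¹ • (f * k))
    (hxf : x * f - f * x = (q - q⁻¹)⁻¹ • (k ^ 2 - k' ^ 2)) (c c' : ℂ) :
    IsLadder q (c * c' / (q - q⁻¹) ^ 2) (c • (x * k)) (c' • (f * k)) (k ^ 2) := by
  refine ⟨?_, ?_, ?_⟩
  · rw [mul_smul_comm, ← mul_assoc, pow_semiconj hx]
    simp only [smul_mul_assoc, mul_assoc, ← pow_succ, ← pow_succ', smul_smul]
    congr 1; ring
  · rw [smul_mul_assoc, mul_smul_comm, ← mul_assoc (k ^ 2), pow_semiconj hf]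
    simp only [smul_mul_assoc, mul_assoc, ← pow_succ, ← pow_succ', smul_smul]
    congr 1; field_simp
  · have h1 : f * k * (x * k) = q • (f * x * k ^ 2) := by
      rw [mul_assoc, ← mul_assoc k, hx, smul_mul_assoc, mul_smul_comm]
      simp only [mul_assoc, pow_two]
    have h2 : x * k * (f * k) = q⁻¹ • (x * f * k ^ 2) := by
      rw [mul_assoc, ← mul_assoc k, hf, smul_mul_assoc, mul_smul_comm]
      simp only [mul_assoc, pow_two]
    have h3 : f * x = x * f - (q - q⁻¹)⁻¹ • (k ^ 2 - k' ^ 2) := by rw [← hxf]; abel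
    have h4 : k' ^ 2 * k ^ 2 = 1 := by
      rw [pow_two, pow_two, mul_assoc, ← mul_assoc k' k, hk, one_mul, hk]
    rw [smul_mul_smul_comm, smul_mul_smul_comm, h1, h2, h3, sub_mul, smul_mul_assoc, sub_mul, h4,
      ← pow_two]
    have h5 : c * c' / (q - q⁻¹) ^ 2 * (q ^ 2 - 1) = c' * c * q * (q - q⁻¹)⁻¹ := by
      have : q ^ 2 - 1 = q * (q - q⁻¹) := by field_simp
      rw [this]; field_simp
    rw [h5]
    simp only [smul_sub, smul_smul]
    rw [show q ^ 2 * (c * c' * q⁻¹) = c' * c * q by field_simp,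
      mul_assoc _ q]

lemma onsagerRHS_add (q : ℂ) (N : ℕ) (ρ : ℕ → ℂ) (x y y' : U) :
    onsagerRHS q N ρ x (y + y') = onsagerRHS q N ρ x y + onsagerRHS q N ρ x y' := by
  simp [onsagerRHS, mul_add, add_mul, Finset.sum_add_distrib]

lemma qSerre_smul (q : ℂ) (m : ℕ) (c : ℂ) (x y : U) :
    qSerre q m x (c • y) = c • qSerre q m x y := by
  simp [qSerre, Finset.smul_sum, smul_comm c]

lemma onsagerRHS_smul (q : ℂ) (N : ℕ) (ρ : ℕ → ℂ) (c : ℂ) (x y : U) :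
    onsagerRHS q N ρ x (c • y) = c • onsagerRHS q N ρ x y := by
  simp [onsagerRHS, Finset.smul_sum, smul_comm c]

/-- The elements `(c e_i k_i + c̄ f_i k_i) ⊗ 1 + k_i ^ 2 ⊗ A_i` satisfy the relations of the
generalized `q`-Onsager algebra if the `A_i` do. -/
lemma onsager_relation_coaction {q β : ℂ} (hq0 : q ≠ 0) (hq : ∀ m : ℕ, 0 < m → q ^ m ≠ 1) {N : ℕ}
    (hN : N ≤ 4) (hγ : GammaDefined q N) (hw : β ^ 2 * q ^ N = 1)
    {e f e' f' k k' l l' : U} (he : IsSerrePair q β N e e' k k' l l')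
    (hf : IsSerrePair q⁻¹ β⁻¹ N f f' k k' l l')
    (hef : e * f - f * e = (q - q⁻¹)⁻¹ • (k ^ 2 - k' ^ 2))
    (hef' : Commute e f') (hfe' : Commute e' f) (c cbar b bbar : ℂ) {A A' : O}
    (hA : qSerre q (N + 1) A A' = onsagerRHS q N (rhoConst q (c * cbar) N) A A') :
    qSerre q (N + 1) ((c • (e * k) + cbar • (f * k)) ⊗ₜ[ℂ] (1 : O) + (k ^ 2) ⊗ₜ[ℂ] A)
        ((b • (e' * l) + bbar • (f' * l)) ⊗ₜ[ℂ] (1 : O) + (l ^ 2) ⊗ₜ[ℂ] A') =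
      onsagerRHS q N (rhoConst q (c * cbar) N)
        ((c • (e * k) + cbar • (f * k)) ⊗ₜ[ℂ] (1 : O) + (k ^ 2) ⊗ₜ[ℂ] A)
        ((b • (e' * l) + bbar • (f' * l)) ⊗ₜ[ℂ] (1 : O) + (l ^ 2) ⊗ₜ[ℂ] A') := by
  have hβ : β ≠ 0 := by rintro rfl; simp at hw
  have hne := sub_inv_ne_zero hq0 hq
  have hq' : ∀ m : ℕ, 0 < m → q⁻¹ ^ m ≠ 1 := fun m hm h => hq m hm <| by
    rwa [inv_pow, inv_eq_one] at h
  have hw' : β⁻¹ ^ 2 * q⁻¹ ^ N = 1 := by rw [inv_pow, inv_pow, ← mul_inv, hw, inv_one]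
  set θ := c * cbar / (q - q⁻¹) ^ 2 with hθ
  have hx : c * cbar = θ * (q - q⁻¹) ^ 2 := by rw [hθ, div_mul_cancel₀ _ (pow_ne_zero 2 hne)]
  have hx' : c * cbar = θ * (q⁻¹ - q⁻¹⁻¹) ^ 2 := by rw [hx, inv_inv]; ring
  have hlad := isLadder_of_sl2 hq0 he.k'_k he.k_x hf.k_x hef c cbar
  rw [← hθ] at hlad
  set ι : U →ₐ[ℂ] U ⊗[ℂ] O := Algebra.TensorProduct.includeLeft with hι
  have hιa : ∀ u, ι u = u ⊗ₜ[ℂ] (1 : O) := fun u => rfl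
  set A₁ : U ⊗[ℂ] O := 1 ⊗ₜ[ℂ] A with hA₁
  have hcomm : ∀ (u : U) (a : O), Commute ((1 : U) ⊗ₜ[ℂ] a) (ι u) := fun u a => by
    simp [commute_iff_eq, hιa]
  have hladι := hlad.map ι
  have hX : (c • (e * k) + cbar • (f * k)) ⊗ₜ[ℂ] (1 : O) + (k ^ 2) ⊗ₜ[ℂ] A =
      ι (c • (e * k)) + ι (cbar • (f * k)) + ι (k ^ 2) * A₁ := by
    simp only [hιa, hA₁, TensorProduct.add_tmul, Algebra.TensorProduct.tmul_mul_tmul, mul_one,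
      one_mul]
  set X := ι (c • (e * k)) + ι (cbar • (f * k)) + ι (k ^ 2) * A₁ with hXdef
  -- the summand `e_j k_j`
  have hY₁ : qSerre q (N + 1) X (ι (e' * l)) =
      onsagerRHS q N (rhoConst q (c * cbar) N) X (ι (e' * l)) := by
    obtain ⟨z, hz, hz1, hzK⟩ := he.exists_string hq0 hq hN hγ hw c
    have hs := hladι.isSerreChain_string (A := A₁) (y := fun m => ι (z m))
      (fun m hm => chainCoeff_ne_zero hw hq hm) (hz.map ι)
      (fun m => by simpa using congrArg ι (hzK m)) (by
        have : cbar • (f * k) * z 1 = β ^ 2 • (z 1 * (cbar • (f * k))) := by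
          have h1 : f * l = β • (l * f) := by rw [hf.l_x, smul_inv_smul₀ hβ]
          rw [hz1, smul_mul_assoc, mul_smul_comm, mul_assoc, ← mul_assoc k, he.k_y,
            smul_mul_assoc, mul_smul_comm, mul_assoc e', he.k_l.eq, ← mul_assoc f, ← hfe'.eq,
            mul_assoc e', ← mul_assoc f, h1]
          simp only [smul_mul_assoc, mul_smul_comm, smul_smul, mul_assoc]
          congr 1; ring
        simpa using congrArg ι this) (fun m => hcomm _ _)
    rw [← add_assoc, ← hXdef] at hs
    have := hs.relation hq0 hq hN hγ hw hx
    rwa [hz1] at this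
  -- the summand `f_j k_j`
  have hY₂ : qSerre q (N + 1) X (ι (f' * l)) =
      onsagerRHS q N (rhoConst q (c * cbar) N) X (ι (f' * l)) := by
    obtain ⟨z, hz, hz1, hzK⟩ := hf.exists_string (inv_ne_zero hq0) hq' hN hγ.inv hw' cbar
    have hs := (hladι.symm hq0).isSerreChain_string (A := A₁) (y := fun m => ι (z m))
      (fun m hm => chainCoeff_ne_zero hw' hq' hm) (hz.map ι)
      (fun m => by simpa using congrArg ι (hzK m)) (by
        have : c • (e * k) * z 1 = β⁻¹ ^ 2 • (z 1 * (c • (e * k))) := by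
          have h1 : e * l = β⁻¹ • (l * e) := by rw [he.l_x, inv_smul_smul₀ hβ]
          rw [hz1, smul_mul_assoc, mul_smul_comm, mul_assoc, ← mul_assoc k, hf.k_y,
            smul_mul_assoc, mul_smul_comm, mul_assoc f', he.k_l.eq, ← mul_assoc e, hef'.eq,
            mul_assoc f', ← mul_assoc e, h1]
          simp only [smul_mul_assoc, mul_smul_comm, smul_smul, mul_assoc]
          congr 1; ring
        simpa using congrArg ι this) (fun m => hcomm _ _)
    rw [← add_assoc, add_comm (ι (cbar • (f * k))), ← hXdef] at hs
    have := hs.relation (inv_ne_zero hq0) hq' hN hγ.inv hw' hx'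
    rw [hz1, qSerre_inv, onsagerRHS_inv] at this
    rw [this]
    congr 1
    funext m
    exact rhoConst_inv q _ N m
  -- the summand `k_j ^ 2 ⊗ A_j`
  have hY₃ : qSerre q (N + 1) X ((l ^ 2) ⊗ₜ[ℂ] A') =
      onsagerRHS q N (rhoConst q (c * cbar) N) X ((l ^ 2) ⊗ₜ[ℂ] A') := by
    have ha := (isSerreChain_of_relation hq0 hq hN hγ hw hx hA).map
      (Algebra.TensorProduct.includeRight : O →ₐ[ℂ] U ⊗[ℂ] O)
    have hJE : l ^ 2 * (c • (e * k)) = β ^ 2 • (c • (e * k) * l ^ 2) := by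
      rw [mul_smul_comm, ← mul_assoc, pow_semiconj he.l_x]
      simp only [smul_mul_assoc, mul_assoc, (he.k_l.pow_right 2).eq, smul_comm c]
    have hJF : cbar • (f * k) * l ^ 2 = β ^ 2 • (l ^ 2 * (cbar • (f * k))) := by
      rw [mul_smul_comm, ← mul_assoc, pow_semiconj hf.l_x]
      simp only [smul_mul_assoc, mul_assoc, (he.k_l.pow_right 2).eq, smul_comm cbar]
      rw [smul_smul, ← mul_pow, mul_inv_cancel₀ hβ, one_pow, one_smul]
    -- Taking `J = l ^ 2` makes the convolution start at `l ^ 2 ⊗ A'`.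
    have hs := hladι.isSerreChain_tensor hq0 hq ha (J := ι (l ^ 2))
      (by simpa using congrArg ι hJE) (by simpa using congrArg ι hJF)
      (by
        have := (he.k_l.symm.pow_pow 2 2).eq
        exact (map_mul ι _ _).symm.trans ((congrArg ι this).trans (map_mul ι _ _)))
      (hcomm _ _) (hcomm _ _) (hcomm _ _) (fun m => hcomm _ _) (fun m => hcomm _ _)
      (fun m => hcomm _ _)
    have := hs.relation hq0 hq hN hγ hw hx
    have h1 : ladderSum q (ι (c • (e * k))) (fun m => ι (k ^ 2) ^ m * ι (l ^ 2) *
        (Algebra.TensorProduct.includeRight : O →ₐ[ℂ] U ⊗[ℂ] O)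
          (chainSeq q (β ^ 2) θ A A' (m + 1))) 1 = (l ^ 2) ⊗ₜ[ℂ] A' := by
      simp [ladderSum, divPow, chainSeq, hιa]
    rw [h1] at this
    exact this
  have hY : (b • (e' * l) + bbar • (f' * l)) ⊗ₜ[ℂ] (1 : O) + (l ^ 2) ⊗ₜ[ℂ] A' =
      b • ι (e' * l) + bbar • ι (f' * l) + (l ^ 2) ⊗ₜ[ℂ] A' := by
    simp only [hιa, TensorProduct.add_tmul, TensorProduct.smul_tmul']
  rw [hX, hY]
  -- Both sides are linear in the second argument, so the three cases add up.
  simp only [IsSerrePair.qSerre_add, onsagerRHS_add, qSerre_smul, onsagerRHS_smul, hY₁, hY₂, hY₃]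

end SerrePairs

/-! ### Bound on the off-diagonal entries. -/

section Cartan

variable {n : ℕ} {a : Matrix (Fin (n + 1)) (Fin (n + 1)) ℤ}

/-- Row `i` of `a u = 0` gives `-a i j * u j ≤ 2 * u i`. Together with the same inequality for `j,
i`, an entry below `-4` would force `5 * u j ≤ 4 * u j`, as `a j i ≤ -1`. -/
lemma IsAffineCartanMatrix.neg_four_le (ha : IsAffineCartanMatrix a) {i j : Fin (n + 1)}
    (hij : i ≠ j) : -4 ≤ a i j := by
  obtain ⟨u, hu, hau⟩ := ha.null
  have key : ∀ i j, i ≠ j → -a i j * u j ≤ 2 * u i := fun i j hij => by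
    have h := congrFun hau i
    rw [Matrix.mulVec, dotProduct, ← Finset.add_sum_erase _ _ (Finset.mem_univ i), ha.diag,
      ← Finset.add_sum_erase _ _ (Finset.mem_erase.2 ⟨hij.symm, Finset.mem_univ j⟩)] at h
    have : ∑ x ∈ (Finset.univ.erase i).erase j, a i x * u x ≤ 0 :=
      Finset.sum_nonpos fun x hx => mul_nonpos_of_nonpos_of_nonneg
        (ha.nonpos i x (Finset.ne_of_mem_erase (Finset.mem_of_mem_erase hx)).symm) (hu x).le
    simp only [Pi.zero_apply] at h
    linarith
  by_contra! hlt
  have h1 := key i j hij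
  have h2 := key j i hij.symm
  have h3 : a j i ≤ -1 := by
    have := ha.nonpos j i hij.symm
    have : a j i ≠ 0 := fun h => by have := ha.zero_symm j i h; omega
    omega
  have := hu i
  have := hu j
  nlinarith

end Cartan

/-! ### Relations in the quotient algebras. -/

namespace Uq

variable {n : ℕ} {a : Matrix (Fin (n + 1)) (Fin (n + 1)) ℤ} {d : Fin (n + 1) → ℕ} {s : ℂ}

lemma k_mul_kinv (i : Fin (n + 1)) : k a d s i * kinv a d s i = 1 := by
  rw [k, kinv, ← map_mul, RingQuot.mkAlgHom_rel ℂ (UqRel.k_kinv i), map_one]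

lemma kinv_mul_k (i : Fin (n + 1)) : kinv a d s i * k a d s i = 1 := by
  rw [k, kinv, ← map_mul, RingQuot.mkAlgHom_rel ℂ (UqRel.kinv_k i), map_one]

lemma commute_k (i j : Fin (n + 1)) : Commute (k a d s i) (k a d s j) := by
  rw [commute_iff_eq, k, k, ← map_mul, RingQuot.mkAlgHom_rel ℂ (UqRel.k_comm i j), map_mul]

lemma k_mul_e (i j : Fin (n + 1)) :
    k a d s i * e a d s j = (s ^ d i) ^ (a i j) • (e a d s j * k a d s i) := by
  have : k a d s i * e a d s j * kinv a d s i = (s ^ d i) ^ (a i j) • e a d s j := by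
    rw [k, kinv, e, ← map_mul, ← map_mul, RingQuot.mkAlgHom_rel ℂ (UqRel.k_e i j), map_smul]
  rw [← smul_mul_assoc, ← this, mul_assoc, kinv_mul_k, mul_one]

lemma k_mul_f (i j : Fin (n + 1)) :
    k a d s i * f a d s j = (s ^ d i) ^ (-(a i j)) • (f a d s j * k a d s i) := by
  have : k a d s i * f a d s j * kinv a d s i = (s ^ d i) ^ (-(a i j)) • f a d s j := by
    rw [k, kinv, f, ← map_mul, ← map_mul, RingQuot.mkAlgHom_rel ℂ (UqRel.k_f i j), map_smul]
  rw [← smul_mul_assoc, ← this, mul_assoc, kinv_mul_k, mul_one]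

lemma e_mul_f_same (i : Fin (n + 1)) : e a d s i * f a d s i - f a d s i * e a d s i =
    (qi d s i - (qi d s i)⁻¹)⁻¹ • (k a d s i ^ 2 - kinv a d s i ^ 2) := by
  rw [k, kinv, e, f, ← map_mul, ← map_mul, ← map_sub, RingQuot.mkAlgHom_rel ℂ (UqRel.e_f_same i),
    map_smul, map_sub, map_pow, map_pow]

lemma e_mul_f {i j : Fin (n + 1)} (h : i ≠ j) :
    e a d s i * f a d s j - f a d s j * e a d s i = 0 := by
  rw [e, f, ← map_mul, ← map_mul, ← map_sub, RingQuot.mkAlgHom_rel ℂ (UqRel.e_f i j h), map_zero]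

end Uq

lemma AlgHom.map_qSerre {B C : Type*} [Ring B] [Algebra ℂ B] [Ring C] [Algebra ℂ C]
    (φ : B →ₐ[ℂ] C) (q : ℂ) (m : ℕ) (x y : B) :
    φ (qSerre q m x y) = qSerre q m (φ x) (φ y) := by
  simp [qSerre]

lemma AlgHom.map_onsagerRHS {B C : Type*} [Ring B] [Algebra ℂ B] [Ring C] [Algebra ℂ C]
    (φ : B →ₐ[ℂ] C) (q : ℂ) (N : ℕ) (ρ : ℕ → ℂ) (x y : B) :
    φ (onsagerRHS q N ρ x y) = onsagerRHS q N ρ (φ x) (φ y) := by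
  simp [onsagerRHS]

namespace Uq

variable {n : ℕ} {a : Matrix (Fin (n + 1)) (Fin (n + 1)) ℤ} {d : Fin (n + 1) → ℕ} {s : ℂ}

lemma qSerre_e {i j : Fin (n + 1)} (h : i ≠ j) :
    qSerre (qi d s i) (1 - a i j).toNat (e a d s i) (e a d s j) = 0 := by
  rw [e, e, ← AlgHom.map_qSerre, RingQuot.mkAlgHom_rel ℂ (UqRel.serre_e i j h), map_zero]

lemma qSerre_f {i j : Fin (n + 1)} (h : i ≠ j) :
    qSerre (qi d s i) (1 - a i j).toNat (f a d s i) (f a d s j) = 0 := by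
  rw [f, f, ← AlgHom.map_qSerre, RingQuot.mkAlgHom_rel ℂ (UqRel.serre_f i j h), map_zero]

lemma algHom_ext {B : Type*} [Semiring B] [Algebra ℂ B] {φ ψ : Uq a d s →ₐ[ℂ] B}
    (he : ∀ i, φ (e a d s i) = ψ (e a d s i)) (hf : ∀ i, φ (f a d s i) = ψ (f a d s i))
    (hk : ∀ i, φ (k a d s i) = ψ (k a d s i)) (hk' : ∀ i, φ (kinv a d s i) = ψ (kinv a d s i)) :
    φ = ψ := by
  apply RingQuot.ringQuot_ext'
  apply FreeAlgebra.hom_ext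
  funext g
  cases g with
  | e i => exact he i
  | f i => exact hf i
  | k i => exact hk i
  | kinv i => exact hk' i

end Uq

lemma Oq.algHom_ext {n : ℕ} {a : Matrix (Fin (n + 1)) (Fin (n + 1)) ℤ} {d : Fin (n + 1) → ℕ}
    {s : ℂ} {ρ : Fin (n + 1) → Fin (n + 1) → ℕ → ℂ} {B : Type*} [Semiring B] [Algebra ℂ B]
    {φ ψ : Oq a d s ρ →ₐ[ℂ] B} (h : ∀ i, φ (Oq.A a d s ρ i) = ψ (Oq.A a d s ρ i)) : φ = ψ := by
  apply RingQuot.ringQuot_ext'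
  apply FreeAlgebra.hom_ext
  funext i
  exact h i

lemma Oq.relation {n : ℕ} {a : Matrix (Fin (n + 1)) (Fin (n + 1)) ℤ} {d : Fin (n + 1) → ℕ}
    {s : ℂ} {ρ : Fin (n + 1) → Fin (n + 1) → ℕ → ℂ} {i j : Fin (n + 1)} (h : i ≠ j) :
    qSerre (qi d s i) (1 - a i j).toNat (Oq.A a d s ρ i) (Oq.A a d s ρ j) =
      onsagerRHS (qi d s i) (-(a i j)).toNat (ρ i j) (Oq.A a d s ρ i) (Oq.A a d s ρ j) := by
  rw [Oq.A, Oq.A, ← AlgHom.map_qSerre, RingQuot.mkAlgHom_rel ℂ (OqRel.rel i j h),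
    AlgHom.map_onsagerRHS]

/-! ### Weights and Serre pairs from the Cartan datum. -/

/-- The hypotheses on the Cartan datum and the deformation parameter. -/
structure IsGenericDatum {n : ℕ} (a : Matrix (Fin (n + 1)) (Fin (n + 1)) ℤ)
    (d : Fin (n + 1) → ℕ) (s : ℂ) : Prop where
  affine : IsAffineCartanMatrix a
  symm : ∀ i j, (d i : ℤ) * a i j = (d j : ℤ) * a j i
  s_ne : s ≠ 0
  not_root : ∀ i, ∀ m : ℕ, 0 < m → qi d s i ^ m ≠ 1
  gamma : ∀ i j, i ≠ j → GammaDefined (qi d s i) (-(a i j)).toNat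

namespace IsGenericDatum

variable {n : ℕ} {a : Matrix (Fin (n + 1)) (Fin (n + 1)) ℤ} {d : Fin (n + 1) → ℕ} {s : ℂ}

lemma sd_ne (_h : IsGenericDatum a d s) (i : Fin (n + 1)) : s ^ d i ≠ 0 := pow_ne_zero _ _h.s_ne

lemma qi_ne (h : IsGenericDatum a d s) (i : Fin (n + 1)) : qi d s i ≠ 0 :=
  pow_ne_zero _ (pow_ne_zero _ h.s_ne)

lemma qi_eq (i : Fin (n + 1)) : qi d s i = (s ^ d i) ^ (2 : ℤ) := by
  rw [qi, ← pow_mul, mul_comm, pow_mul]; norm_cast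

lemma toNat_le (h : IsGenericDatum a d s) {i j : Fin (n + 1)} (hij : i ≠ j) :
    (-(a i j)).toNat ≤ 4 := by
  have := h.affine.neg_four_le hij
  omega

lemma toNat_succ (h : IsGenericDatum a d s) {i j : Fin (n + 1)} (hij : i ≠ j) :
    (1 - a i j).toNat = (-(a i j)).toNat + 1 := by
  have := h.affine.nonpos i j hij
  omega

lemma weight (h : IsGenericDatum a d s) {i j : Fin (n + 1)} (hij : i ≠ j) :
    ((s ^ d i) ^ (a i j)) ^ 2 * qi d s i ^ (-(a i j)).toNat = 1 := by
  have h1 : (((-(a i j)).toNat : ℕ) : ℤ) = -(a i j) :=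
    Int.toNat_of_nonneg (by have := h.affine.nonpos i j hij; omega)
  have h2 : a i j = -((-(a i j)).toNat : ℤ) := by rw [h1, neg_neg]
  generalize (-(a i j)).toNat = N at h2 ⊢
  rw [h2, qi_eq, zpow_neg, zpow_natCast, zpow_ofNat, inv_pow, pow_right_comm,
    inv_mul_cancel₀ (pow_ne_zero _ (pow_ne_zero _ (h.sd_ne i)))]

/-- Symmetrizability enters here: `k_j` scales `e_i` just as `k_i` scales `e_j`. -/
lemma weight_symm (h : IsGenericDatum a d s) (i j : Fin (n + 1)) :
    (s ^ d j) ^ (a j i) = (s ^ d i) ^ (a i j) := by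
  rw [← zpow_natCast, ← zpow_natCast, ← zpow_mul, ← zpow_mul, h.symm]

lemma isSerrePair_e (h : IsGenericDatum a d s) {i j : Fin (n + 1)} (hij : i ≠ j) :
    IsSerrePair (qi d s i) ((s ^ d i) ^ (a i j)) (-(a i j)).toNat (Uq.e a d s i) (Uq.e a d s j)
      (Uq.k a d s i) (Uq.kinv a d s i) (Uq.k a d s j) (Uq.kinv a d s j) where
  k_k' := Uq.k_mul_kinv i
  k'_k := Uq.kinv_mul_k i
  l_l' := Uq.k_mul_kinv j
  l'_l := Uq.kinv_mul_k j
  k_l := Uq.commute_k i j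
  k_x := by rw [Uq.k_mul_e, h.affine.diag, qi_eq]
  k_y := Uq.k_mul_e i j
  l_x := by rw [Uq.k_mul_e, h.weight_symm]
  serre := by rw [← h.toNat_succ hij, Uq.qSerre_e hij]

lemma isSerrePair_f (h : IsGenericDatum a d s) {i j : Fin (n + 1)} (hij : i ≠ j) :
    IsSerrePair (qi d s i)⁻¹ ((s ^ d i) ^ (a i j))⁻¹ (-(a i j)).toNat (Uq.f a d s i)
      (Uq.f a d s j) (Uq.k a d s i) (Uq.kinv a d s i) (Uq.k a d s j) (Uq.kinv a d s j) where
  k_k' := Uq.k_mul_kinv i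
  k'_k := Uq.kinv_mul_k i
  l_l' := Uq.k_mul_kinv j
  l'_l := Uq.kinv_mul_k j
  k_l := Uq.commute_k i j
  k_x := by rw [Uq.k_mul_f, h.affine.diag, qi_eq, zpow_neg]
  k_y := by rw [Uq.k_mul_f, zpow_neg]
  l_x := by rw [Uq.k_mul_f, zpow_neg, h.weight_symm]
  serre := by rw [← h.toNat_succ hij, qSerre_inv, Uq.qSerre_f hij]

lemma kinv_mul_e (h : IsGenericDatum a d s) (i j : Fin (n + 1)) :
    Uq.kinv a d s i * Uq.e a d s j =
      ((s ^ d i) ^ (a i j))⁻¹ • (Uq.e a d s j * Uq.kinv a d s i) :=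
  inv_semiconj (zpow_ne_zero _ (h.sd_ne i)) (Uq.k_mul_kinv i) (Uq.kinv_mul_k i) (Uq.k_mul_e i j)

lemma kinv_mul_f (h : IsGenericDatum a d s) (i j : Fin (n + 1)) :
    Uq.kinv a d s i * Uq.f a d s j =
      ((s ^ d i) ^ (a i j)) • (Uq.f a d s j * Uq.kinv a d s i) := by
  have := inv_semiconj (zpow_ne_zero (-(a i j)) (h.sd_ne i)) (Uq.k_mul_kinv i)
    (Uq.kinv_mul_k i) (Uq.k_mul_f (a := a) i j)
  rwa [zpow_neg, inv_inv] at this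

lemma not_root_inv (h : IsGenericDatum a d s) (i : Fin (n + 1)) (m : ℕ) (hm : 0 < m) :
    (qi d s i)⁻¹ ^ m ≠ 1 := fun h1 => h.not_root i m hm <| by
  rwa [inv_pow, inv_eq_one] at h1

/-- The mixed terms cancel: reordering them produces the same power of `s` in both tensor factors,
by `weight_symm`. -/
lemma comul_commutator (h : IsGenericDatum a d s) (i j : Fin (n + 1)) :
    (Uq.e a d s i ⊗ₜ[ℂ] Uq.kinv a d s i + Uq.k a d s i ⊗ₜ[ℂ] Uq.e a d s i) *
        (Uq.f a d s j ⊗ₜ[ℂ] Uq.kinv a d s j + Uq.k a d s j ⊗ₜ[ℂ] Uq.f a d s j) -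
      (Uq.f a d s j ⊗ₜ[ℂ] Uq.kinv a d s j + Uq.k a d s j ⊗ₜ[ℂ] Uq.f a d s j) *
        (Uq.e a d s i ⊗ₜ[ℂ] Uq.kinv a d s i + Uq.k a d s i ⊗ₜ[ℂ] Uq.e a d s i) =
      (Uq.e a d s i * Uq.f a d s j - Uq.f a d s j * Uq.e a d s i) ⊗ₜ[ℂ]
        (Uq.kinv a d s i * Uq.kinv a d s j) +
      (Uq.k a d s i * Uq.k a d s j) ⊗ₜ[ℂ]
        (Uq.e a d s i * Uq.f a d s j - Uq.f a d s j * Uq.e a d s i) := by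
  have hkk : Uq.kinv a d s j * Uq.kinv a d s i = Uq.kinv a d s i * Uq.kinv a d s j := by
    by_cases hij : i = j
    · rw [hij]
    · exact (h.isSerrePair_e hij).l'_k'.eq
  simp only [mul_add, add_mul, Algebra.TensorProduct.tmul_mul_tmul, h.kinv_mul_f, h.kinv_mul_e,
    Uq.k_mul_e, Uq.k_mul_f, h.weight_symm i j, (Uq.commute_k j i).eq, hkk,
    TensorProduct.sub_tmul, TensorProduct.tmul_sub, TensorProduct.tmul_smul,
    ← TensorProduct.smul_tmul', zpow_neg]
  abel

end IsGenericDatum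

/-! ### The bialgebra structure. -/

namespace Uq

variable {n : ℕ} {a : Matrix (Fin (n + 1)) (Fin (n + 1)) ℤ} {d : Fin (n + 1) → ℕ} {s : ℂ}

/-- The comultiplication on generators. -/
noncomputable def comulGen (a : Matrix (Fin (n + 1)) (Fin (n + 1)) ℤ) (d : Fin (n + 1) → ℕ)
    (s : ℂ) : UqGen n → Uq a d s ⊗[ℂ] Uq a d s
  | .e i => e a d s i ⊗ₜ kinv a d s i + k a d s i ⊗ₜ e a d s i
  | .f i => f a d s i ⊗ₜ kinv a d s i + k a d s i ⊗ₜ f a d s i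
  | .k i => k a d s i ⊗ₜ k a d s i
  | .kinv i => kinv a d s i ⊗ₜ kinv a d s i

lemma comulGen_rel (h : IsGenericDatum a d s) {x y : FreeAlgebra ℂ (UqGen n)}
    (hxy : UqRel a d s x y) :
    FreeAlgebra.lift ℂ (comulGen a d s) x = FreeAlgebra.lift ℂ (comulGen a d s) y := by
  have hE : ∀ i, FreeAlgebra.lift ℂ (comulGen a d s) (UqGen.E i) =
      e a d s i ⊗ₜ kinv a d s i + k a d s i ⊗ₜ e a d s i :=
    fun i => FreeAlgebra.lift_ι_apply _ _
  have hF : ∀ i, FreeAlgebra.lift ℂ (comulGen a d s) (UqGen.F i) =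
      f a d s i ⊗ₜ kinv a d s i + k a d s i ⊗ₜ f a d s i :=
    fun i => FreeAlgebra.lift_ι_apply _ _
  have hK : ∀ i, FreeAlgebra.lift ℂ (comulGen a d s) (UqGen.K i) = k a d s i ⊗ₜ k a d s i :=
    fun i => FreeAlgebra.lift_ι_apply _ _
  have hK' : ∀ i, FreeAlgebra.lift ℂ (comulGen a d s) (UqGen.Kinv i) =
      kinv a d s i ⊗ₜ kinv a d s i := fun i => FreeAlgebra.lift_ι_apply _ _
  have hkkk : ∀ i j, k a d s i * k a d s j * kinv a d s i = k a d s j := fun i j => by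
    rw [(commute_k i j).eq, mul_assoc, k_mul_kinv, mul_one]
  have hkkk' : ∀ i j, k a d s i * kinv a d s j * kinv a d s i = kinv a d s j := fun i j => by
    have : kinv a d s j * kinv a d s i = kinv a d s i * kinv a d s j := by
      by_cases hij : i = j
      · rw [hij]
      · exact (h.isSerrePair_e hij).l'_k'.eq
    rw [mul_assoc, this, ← mul_assoc, k_mul_kinv, one_mul]
  have hke : ∀ i j, k a d s i * e a d s j * kinv a d s i = (s ^ d i) ^ (a i j) • e a d s j :=
    fun i j => by rw [k_mul_e, smul_mul_assoc, mul_assoc, k_mul_kinv, mul_one]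
  have hkf : ∀ i j, k a d s i * f a d s j * kinv a d s i = (s ^ d i) ^ (-(a i j)) • f a d s j :=
    fun i j => by rw [k_mul_f, smul_mul_assoc, mul_assoc, k_mul_kinv, mul_one]
  cases hxy with
  | k_kinv i =>
    rw [map_mul, hK, hK', Algebra.TensorProduct.tmul_mul_tmul, k_mul_kinv, map_one]; rfl
  | kinv_k i =>
    rw [map_mul, hK, hK', Algebra.TensorProduct.tmul_mul_tmul, kinv_mul_k, map_one]; rfl
  | k_comm i j =>
    rw [map_mul, map_mul, hK, hK, Algebra.TensorProduct.tmul_mul_tmul,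
      Algebra.TensorProduct.tmul_mul_tmul, (commute_k i j).eq]
  | k_e i j =>
    rw [map_mul, map_mul, map_smul, hK, hK', hE]
    simp only [mul_add, add_mul, Algebra.TensorProduct.tmul_mul_tmul, hkkk, hkkk', hke,
      TensorProduct.tmul_smul, ← TensorProduct.smul_tmul', smul_add]
  | k_f i j =>
    rw [map_mul, map_mul, map_smul, hK, hK', hF]
    simp only [mul_add, add_mul, Algebra.TensorProduct.tmul_mul_tmul, hkkk, hkkk', hkf,
      TensorProduct.tmul_smul, ← TensorProduct.smul_tmul', smul_add]
  | e_f_same i =>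
    rw [map_sub, map_mul, map_mul, map_smul, map_sub, map_pow, map_pow, hE, hF, hK, hK',
      h.comul_commutator, e_mul_f_same]
    -- The sum telescopes: the two copies of `k ^ 2 ⊗ kinv ^ 2` cancel.
    simp only [pow_two, Algebra.TensorProduct.tmul_mul_tmul, TensorProduct.tmul_smul,
      ← TensorProduct.smul_tmul', TensorProduct.sub_tmul, TensorProduct.tmul_sub, smul_sub]
    abel
  | e_f i j hij =>
    rw [map_sub, map_mul, map_mul, hE, hF, h.comul_commutator, e_mul_f hij, map_zero,
      TensorProduct.zero_tmul, TensorProduct.tmul_zero, add_zero]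
  | serre_e i j hij =>
    refine (AlgHom.map_qSerre (FreeAlgebra.lift ℂ (comulGen a d s)) _ _ _ _).trans ?_
    rw [hE, hE, map_zero, h.toNat_succ hij]
    exact (h.isSerrePair_e hij).qSerre_comul (h.qi_ne i) (h.not_root i) (h.toNat_le hij)
      (h.gamma i j hij) (h.weight hij)
  | serre_f i j hij =>
    refine (AlgHom.map_qSerre (FreeAlgebra.lift ℂ (comulGen a d s)) _ _ _ _).trans ?_
    rw [hF, hF, map_zero, h.toNat_succ hij, ← qSerre_inv]
    refine (h.isSerrePair_f hij).qSerre_comul (inv_ne_zero (h.qi_ne i)) (h.not_root_inv i)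
      (h.toNat_le hij) (h.gamma i j hij).inv ?_
    rw [inv_pow, inv_pow, ← mul_inv, h.weight hij, inv_one]

/-- The comultiplication of the quantum affine algebra. -/
noncomputable def comul (h : IsGenericDatum a d s) : Uq a d s →ₐ[ℂ] Uq a d s ⊗[ℂ] Uq a d s :=
  RingQuot.liftAlgHom ℂ ⟨FreeAlgebra.lift ℂ (comulGen a d s), fun _ _ => comulGen_rel h⟩

lemma comul_e (h : IsGenericDatum a d s) (i : Fin (n + 1)) :
    comul h (e a d s i) = e a d s i ⊗ₜ kinv a d s i + k a d s i ⊗ₜ e a d s i :=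
  (RingQuot.liftAlgHom_mkAlgHom_apply _ _ _ _).trans (FreeAlgebra.lift_ι_apply _ _)

lemma comul_f (h : IsGenericDatum a d s) (i : Fin (n + 1)) :
    comul h (f a d s i) = f a d s i ⊗ₜ kinv a d s i + k a d s i ⊗ₜ f a d s i :=
  (RingQuot.liftAlgHom_mkAlgHom_apply _ _ _ _).trans (FreeAlgebra.lift_ι_apply _ _)

lemma comul_k (h : IsGenericDatum a d s) (i : Fin (n + 1)) :
    comul h (k a d s i) = k a d s i ⊗ₜ k a d s i :=
  (RingQuot.liftAlgHom_mkAlgHom_apply _ _ _ _).trans (FreeAlgebra.lift_ι_apply _ _)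

lemma comul_kinv (h : IsGenericDatum a d s) (i : Fin (n + 1)) :
    comul h (kinv a d s i) = kinv a d s i ⊗ₜ kinv a d s i :=
  (RingQuot.liftAlgHom_mkAlgHom_apply _ _ _ _).trans (FreeAlgebra.lift_ι_apply _ _)

/-- The counit on generators. -/
def counitGen : UqGen n → ℂ
  | .e _ => 0
  | .f _ => 0
  | .k _ => 1
  | .kinv _ => 1

lemma counitGen_rel {x y : FreeAlgebra ℂ (UqGen n)}
    (hxy : UqRel a d s x y) :
    FreeAlgebra.lift ℂ counitGen x = FreeAlgebra.lift ℂ counitGen y := by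
  have hE : ∀ i : Fin (n + 1), FreeAlgebra.lift ℂ counitGen (UqGen.E i) = 0 :=
    fun i => FreeAlgebra.lift_ι_apply _ _
  have hF : ∀ i : Fin (n + 1), FreeAlgebra.lift ℂ counitGen (UqGen.F i) = 0 :=
    fun i => FreeAlgebra.lift_ι_apply _ _
  have hK : ∀ i : Fin (n + 1), FreeAlgebra.lift ℂ counitGen (UqGen.K i) = 1 :=
    fun i => FreeAlgebra.lift_ι_apply _ _
  have hK' : ∀ i : Fin (n + 1), FreeAlgebra.lift ℂ counitGen (UqGen.Kinv i) = 1 :=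
    fun i => FreeAlgebra.lift_ι_apply _ _
  cases hxy with
  | serre_e i j hij => rw [AlgHom.map_qSerre, hE, hE, map_zero]; simp [qSerre]
  | serre_f i j hij => rw [AlgHom.map_qSerre, hF, hF, map_zero]; simp [qSerre]
  | _ => simp [hE, hF, hK, hK']

/-- The counit of the quantum affine algebra. -/
noncomputable def counit (a : Matrix (Fin (n + 1)) (Fin (n + 1)) ℤ) (d : Fin (n + 1) → ℕ)
    (s : ℂ) : Uq a d s →ₐ[ℂ] ℂ :=
  RingQuot.liftAlgHom ℂ ⟨FreeAlgebra.lift ℂ counitGen, fun _ _ => counitGen_rel⟩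

lemma counit_e (i : Fin (n + 1)) : counit a d s (e a d s i) = 0 :=
  (RingQuot.liftAlgHom_mkAlgHom_apply _ _ _ _).trans (FreeAlgebra.lift_ι_apply _ _)

lemma counit_f (i : Fin (n + 1)) : counit a d s (f a d s i) = 0 :=
  (RingQuot.liftAlgHom_mkAlgHom_apply _ _ _ _).trans (FreeAlgebra.lift_ι_apply _ _)

lemma counit_k (i : Fin (n + 1)) : counit a d s (k a d s i) = 1 :=
  (RingQuot.liftAlgHom_mkAlgHom_apply _ _ _ _).trans (FreeAlgebra.lift_ι_apply _ _)

lemma counit_kinv (i : Fin (n + 1)) : counit a d s (kinv a d s i) = 1 :=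
  (RingQuot.liftAlgHom_mkAlgHom_apply _ _ _ _).trans (FreeAlgebra.lift_ι_apply _ _)

lemma comul_coassoc (h : IsGenericDatum a d s) :
    (Algebra.TensorProduct.assoc ℂ ℂ ℂ _ _ _).toAlgHom.comp
      ((Algebra.TensorProduct.map (comul h) (.id ℂ _)).comp (comul h)) =
    (Algebra.TensorProduct.map (.id ℂ _) (comul h)).comp (comul h) := by
  apply algHom_ext <;> intro i <;>
    simp [comul_e, comul_f, comul_k, comul_kinv, TensorProduct.add_tmul, TensorProduct.tmul_add,
      add_assoc]

lemma comul_counit_left (h : IsGenericDatum a d s) :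
    (Algebra.TensorProduct.map (counit a d s) (.id ℂ _)).comp (comul h) =
      (Algebra.TensorProduct.lid ℂ (Uq a d s)).symm := by
  apply algHom_ext <;> intro i <;>
    simp [comul_e, comul_f, comul_k, comul_kinv, counit_e, counit_f, counit_k, counit_kinv]

lemma comul_counit_right (h : IsGenericDatum a d s) :
    (Algebra.TensorProduct.map (.id ℂ _) (counit a d s)).comp (comul h) =
      (Algebra.TensorProduct.rid ℂ ℂ (Uq a d s)).symm := by
  apply algHom_ext <;> intro i <;>
    simp [comul_e, comul_f, comul_k, comul_kinv, counit_e, counit_f, counit_k, counit_kinv]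

end Uq

/-! ### The coaction and the comodule algebra axioms. -/

namespace Oq

variable {n : ℕ} {a : Matrix (Fin (n + 1)) (Fin (n + 1)) ℤ} {d : Fin (n + 1) → ℕ} {s : ℂ}

/-- The coaction on generators. -/
noncomputable def coactionGen (a : Matrix (Fin (n + 1)) (Fin (n + 1)) ℤ) (d : Fin (n + 1) → ℕ)
    (s : ℂ) (c cbar : Fin (n + 1) → ℂ) (i : Fin (n + 1)) :
    Uq a d s ⊗[ℂ] Oq a d s (onsagerRho a d s c cbar) :=
  (c i • (Uq.e a d s i * Uq.k a d s i) + cbar i • (Uq.f a d s i * Uq.k a d s i)) ⊗ₜ 1 +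
    (Uq.k a d s i ^ 2) ⊗ₜ Oq.A a d s _ i

lemma coactionGen_rel (h : IsGenericDatum a d s) (c cbar : Fin (n + 1) → ℂ)
    {x y : FreeAlgebra ℂ (Fin (n + 1))} (hxy : OqRel a d s (onsagerRho a d s c cbar) x y) :
    FreeAlgebra.lift ℂ (coactionGen a d s c cbar) x =
      FreeAlgebra.lift ℂ (coactionGen a d s c cbar) y := by
  obtain ⟨i, j, hij⟩ := hxy
  have hA := Oq.relation (a := a) (d := d) (s := s) (ρ := onsagerRho a d s c cbar) hij
  refine (AlgHom.map_qSerre (FreeAlgebra.lift ℂ (coactionGen a d s c cbar)) _ _ _ _).trans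
    (Eq.trans ?_
      (AlgHom.map_onsagerRHS (FreeAlgebra.lift ℂ (coactionGen a d s c cbar)) _ _ _ _ _).symm)
  rw [FreeAlgebra.lift_ι_apply, FreeAlgebra.lift_ι_apply]
  rw [h.toNat_succ hij] at hA ⊢
  have hc : ∀ i j, i ≠ j → Commute (Uq.e a d s i) (Uq.f a d s j) :=
    fun i j hij => sub_eq_zero.1 (Uq.e_mul_f hij)
  exact onsager_relation_coaction (h.qi_ne i) (h.not_root i) (h.toNat_le hij) (h.gamma i j hij)
    (h.weight hij) (h.isSerrePair_e hij) (h.isSerrePair_f hij) (Uq.e_mul_f_same i) (hc i j hij)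
    (hc j i hij.symm) (c i) (cbar i) (c j) (cbar j) hA

/-- The coaction of the quantum affine algebra on the generalized `q`-Onsager algebra. -/
noncomputable def coaction (h : IsGenericDatum a d s) (c cbar : Fin (n + 1) → ℂ) :
    Oq a d s (onsagerRho a d s c cbar) →ₐ[ℂ]
      Uq a d s ⊗[ℂ] Oq a d s (onsagerRho a d s c cbar) :=
  RingQuot.liftAlgHom ℂ
    ⟨FreeAlgebra.lift ℂ (coactionGen a d s c cbar), fun _ _ => coactionGen_rel h c cbar⟩

lemma coaction_A (h : IsGenericDatum a d s) (c cbar : Fin (n + 1) → ℂ) (i : Fin (n + 1)) :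
    coaction h c cbar (Oq.A a d s _ i) =
      (c i • (Uq.e a d s i * Uq.k a d s i) + cbar i • (Uq.f a d s i * Uq.k a d s i)) ⊗ₜ 1 +
        (Uq.k a d s i ^ 2) ⊗ₜ Oq.A a d s _ i :=
  (RingQuot.liftAlgHom_mkAlgHom_apply _ _ _ _).trans (FreeAlgebra.lift_ι_apply _ _)

lemma coaction_coassoc (h : IsGenericDatum a d s) (c cbar : Fin (n + 1) → ℂ) :
    (Algebra.TensorProduct.assoc ℂ ℂ ℂ _ _ _).toAlgHom.comp
      ((Algebra.TensorProduct.map (Uq.comul h) (.id ℂ _)).comp (coaction h c cbar)) =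
    (Algebra.TensorProduct.map (.id ℂ _) (coaction h c cbar)).comp (coaction h c cbar) := by
  apply algHom_ext
  intro i
  -- Since `kinv * k = 1`, the coproduct of `e k` is `e k ⊗ 1 + k ^ 2 ⊗ e k`, and likewise for `f
  -- k`; this matches the shape of the coaction.
  simp [coaction_A, Uq.comul_e, Uq.comul_f, Uq.comul_k, TensorProduct.add_tmul,
    TensorProduct.tmul_add, add_mul, Uq.kinv_mul_k, ← pow_two, TensorProduct.tmul_smul,
    ← TensorProduct.smul_tmul', Algebra.TensorProduct.one_def]
  abel

lemma coaction_counit (h : IsGenericDatum a d s) (c cbar : Fin (n + 1) → ℂ) :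
    (Algebra.TensorProduct.lid ℂ _).toAlgHom.comp
      ((Algebra.TensorProduct.map (Uq.counit a d s) (.id ℂ _)).comp (coaction h c cbar)) =
    AlgHom.id ℂ _ := by
  apply algHom_ext
  intro i
  simp [coaction_A, Uq.counit_e, Uq.counit_f, Uq.counit_k]

end Oq

theorem proposition2p2 {n : ℕ} (a : Matrix (Fin (n + 1)) (Fin (n + 1)) ℤ)
    (ha : IsAffineCartanMatrix a) (d : Fin (n + 1) → ℕ) (hd : ∀ i, 0 < d i)
    (hd_coprime : Finset.univ.gcd d = 1)
    (hd_symm : ∀ i j, (d i : ℤ) * a i j = (d j : ℤ) * a j i)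
    (q s : ℂ) (hs : s ^ 2 = q) (hq_ne : q ≠ 0) (hq : ∀ m : ℕ, 0 < m → q ^ m ≠ 1)
    (h_triple : ∀ i j, a i j = -3 →
      qi d s i ^ 4 + 2 * qi d s i ^ 2 + 4 + 2 * (qi d s i)⁻¹ ^ 2 + (qi d s i)⁻¹ ^ 4 ≠ 0)
    (h_quadruple : ∀ i j, a i j = -4 → qi d s i ^ 4 + (qi d s i)⁻¹ ^ 4 + 3 ≠ 0)
    (c cbar : Fin (n + 1) → ℂ) :
    ∃ (Δ : Uq a d s →ₐ[ℂ] Uq a d s ⊗[ℂ] Uq a d s) (ε : Uq a d s →ₐ[ℂ] ℂ)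
      (h_coassoc : (Algebra.TensorProduct.assoc ℂ ℂ ℂ _ _ _).toAlgHom.comp
          ((Algebra.TensorProduct.map Δ (.id ℂ _)).comp Δ) =
        (Algebra.TensorProduct.map (.id ℂ _) Δ).comp Δ)
      (h_counit_left : (Algebra.TensorProduct.map ε (.id ℂ _)).comp Δ =
        (Algebra.TensorProduct.lid ℂ (Uq a d s)).symm)
      (h_counit_right : (Algebra.TensorProduct.map (.id ℂ _) ε).comp Δ =
        (Algebra.TensorProduct.rid ℂ ℂ (Uq a d s)).symm),
      (∀ i, Δ (Uq.e a d s i) =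
        Uq.e a d s i ⊗ₜ Uq.kinv a d s i + Uq.k a d s i ⊗ₜ Uq.e a d s i) ∧
      (∀ i, Δ (Uq.f a d s i) =
        Uq.f a d s i ⊗ₜ Uq.kinv a d s i + Uq.k a d s i ⊗ₜ Uq.f a d s i) ∧
      (∀ i, Δ (Uq.k a d s i) = Uq.k a d s i ⊗ₜ Uq.k a d s i) ∧
      (∀ i, Δ (Uq.kinv a d s i) = Uq.kinv a d s i ⊗ₜ Uq.kinv a d s i) ∧
      (∀ i, ε (Uq.e a d s i) = 0) ∧ (∀ i, ε (Uq.f a d s i) = 0) ∧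
      (∀ i, ε (Uq.k a d s i) = 1) ∧ (∀ i, ε (Uq.kinv a d s i) = 1) ∧
      letI : Bialgebra ℂ (Uq a d s) :=
        Bialgebra.ofAlgHom Δ ε h_coassoc h_counit_left h_counit_right
      ∃ δ : Oq a d s (onsagerRho a d s c cbar) →ₐ[ℂ]
          Uq a d s ⊗[ℂ] Oq a d s (onsagerRho a d s c cbar),
        (∀ i, δ (Oq.A a d s _ i) =
          (c i • (Uq.e a d s i * Uq.k a d s i) + cbar i • (Uq.f a d s i * Uq.k a d s i)) ⊗ₜ 1 +
            (Uq.k a d s i ^ 2) ⊗ₜ Oq.A a d s _ i) ∧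
        IsLeftComoduleAlgebra ℂ δ := by

  have hs0 : s ≠ 0 := by rintro rfl; exact hq_ne (by rw [← hs]; simp)
  have h : IsGenericDatum a d s :=
    { affine := ha
      symm := hd_symm
      s_ne := hs0
      not_root := fun i m hm => by
        rw [qi, hs, ← pow_mul]
        exact hq _ (Nat.mul_pos (hd i) hm)
      gamma := fun i j hij => by
        refine ⟨fun hN => h_triple i j (by omega), fun hN => h_quadruple i j (by omega)⟩ }
  let : Bialgebra ℂ (Uq a d s) := Bialgebra.ofAlgHom (Uq.comul h) (Uq.counit a d s)
    (Uq.comul_coassoc h) (Uq.comul_counit_left h) (Uq.comul_counit_right h)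
  exact ⟨Uq.comul h, Uq.counit a d s, Uq.comul_coassoc h, Uq.comul_counit_left h,
    Uq.comul_counit_right h, Uq.comul_e h, Uq.comul_f h, Uq.comul_k h, Uq.comul_kinv h,
    Uq.counit_e, Uq.counit_f, Uq.counit_k, Uq.counit_kinv, Oq.coaction h c cbar,
    Oq.coaction_A h c cbar, ⟨Oq.coaction_coassoc h c cbar, Oq.coaction_counit h c cbar⟩⟩
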